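/- **Setting.** Let $\mathcal E,\mathcal E_*$ be complex Hilbert spaces and $d\ge 0$ an integer. Formal Laurent series in $z=(z_1,\dots,z_d)$ carry no restriction on supports, $\mathbf e_k$ is the $k$-th unit multi-index, and $S(w)^*=\sum_n S_n^*w^{-n}$ for $S(z)=\sum_n S_nz^n$ (with $S_n=0$ for $n\notin\mathbb Z^d_+$). A *GR-unitary colligation* with state space $\mathcal H$, input space $\mathcal U$ and output space $\mathcal Y$ is a unitary $U=\begin{bmatrix}A&B\\C&D\end{bmatrix}:\mathcal H\oplus\mathcal U\to\mathcal H\oplus\mathcal Y$ together with orthogonal projections $P_1,\dots,P_d$ on $\mathcal H$ with pairwise orthogonal ranges and $\sum_kP_k=I$ (so $\mathcal H=\bigoplus_k\mathcal H_k$, $\mathcal H_k=\operatorname{im}P_k$). Put $Z(z)=\sum_kz_kP_k$. With $\mathcal U=\mathcal E$ and $\mathcal Y=\mathcal E_*$, $U$ *realizes* $S$ if $S(z)=D+C(I-Z(z)A)^{-1}Z(z)B$. It is *closely connected* if $\mathcal H$ is the smallest closed subspace containing $\operatorname{im}B$ and $\operatorname{im}C^*$ and invariant under $A$, $A^*$ and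 all $P_k$. Two colligations with the same input and output spaces are *unitarily equivalent* via a unitary $\omega:\mathcal H\to\mathcal H'$ if $\omega P_k=P_k'\omega$ for all $k$ and $U'(\omega\oplus I)=(\omega\oplus I)U$. Let $S(z)=\sum_{n\in\mathbb Z_+^d}S_nz^n$, $S_n\in\mathcal L(\mathcal E,\mathcal E_*)$, be in the Schur–Agler class (the series converges on the polydisk and $\|\sum S_n\otimes T^n\|\le1$ for each commuting $d$-tuple $T$ of strict contractions on a Hilbert space), and let an *augmented Agler decomposition* of $S$ be given: positive kernels $K_k(z,w)=\sum_{n,m\in\mathbb Z^d}[K_k]_{n,m}z^nw^{-m}$, $k=1,\dots,d$, with coefficients in $\mathcal L(\mathcal E_*\oplus\mathcal E)$ and $$\begin{bmatrix}I-S(z)S(w)^*&S(w)-S(z)\\S(z)^*-S(w)^*&S(z)^*S(w)-I\end{bmatrix}=\sum_{k=1}^d(1-z_kw_k^{-1})K_k(z,w),$$ where the $\mathcal E_*$-component of $[K_k]_{n,m}u$ vanishes unless $n\in\mathbb Z_+^d$ and its $\mathcal E$-component vanishes unless $-(n+\mathbf e_k)\in\mathbb Z_+^d$ (i.e. $K_k(z,w)=H_k(z)H_k(w)^*$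 with $H_k=\begin{bmatrix}H_k^1(z)\\z_k^{-1}H_k^2(z^{-1})\end{bmatrix}$ and $H_k^1,H_k^2$ power series). A GR-unitary colligation is *compatible* with $\{K_k\}$ if $K_k(z,w)=H_k(z)H_k(w)^*$ for $H_k(z)=\begin{bmatrix}C(I-Z(z)A)^{-1}\\z_k^{-1}B^*(I-Z(z)^{-1}A^*)^{-1}\end{bmatrix}P_k$ and each $k$. Let $\mathcal H(K_k)$ be the formal reproducing kernel Hilbert space of $K_k$, $[K_k]_m(z)=\sum_n[K_k]_{n,m}z^n$, and $\mathcal M=\bigoplus_{k=1}^d\mathcal H(K_k)$ (external orthogonal sum, with its coordinate projections). Let $\mathcal D\subset\mathcal M\oplus\mathcal E$ and $\mathcal R\subset\mathcal M\oplus\mathcal E_*$ be the closed spans, over $m\in\mathbb Z^d$, $e_*\in\mathcal E_*$, $e\in\mathcal E$, of the vectors $$g_m(e_*,e)=\Big(\big([K_k]_m(z)\begin{bmatrix}e_*\\e\end{bmatrix}\big)_{k},\;S_m^*e_*+\delta_{m,0}e\Big),\qquad g'_m(e_*,e)=\Big(\big([K_k]_{m-\mathbf e_k}(z)\begin{bmatrix}e_*\\e\end{bmatrix}\big)_{k},\;\delta_{m,0}e_*+S_{-m}e\Big),$$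 and let $\mathcal L=\{(f_k)\in\mathcal M:\sum_kf_k=0\}$ and $\mathcal L'=\{(f_k)\in\mathcal M:\sum_kz_kf_k=0\}$ be the overlapping spaces of $\{K_k\}$ and of $\{z_kK_kw_k^{-1}\}$ (the latter after identifying $\mathcal H(z_kK_kw_k^{-1})=z_k\mathcal H(K_k)$ with $\mathcal H(K_k)$). **Theorem 7.1.** There is a unique unitary $V:\mathcal D\to\mathcal R$ with $V g_m(e_*,e)=g_m'(e_*,e)$ for all $m,e_*,e$, and a unique unitary $U_0=[U_{0,ij}]_{i,j=1}^3:\mathcal M\oplus\mathcal E\oplus\mathcal L'\to\mathcal M\oplus\mathcal E_*\oplus\mathcal L$ with $U_0(x,0)=(Vx,0)$ for $x\in\mathcal D$, $U_0(\ell,0,0)=(0,0,\ell)$ for $\ell\in\mathcal L$ and $U_0(0,0,\ell')=(\ell',0,0)$ for $\ell'\in\mathcal L'$. For a Hilbert space $\widetilde{\mathcal H}$ call a GR-unitary colligation $U$ with state space $\mathcal M\oplus\widetilde{\mathcal H}$, input space $\mathcal E$ and output space $\mathcal E_*$ a *unitary extension of $V$* if each of its projections $P_k$ is the direct sum of the projection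 of $\mathcal M$ onto $\mathcal H(K_k)$ and an operator $\widetilde P_k$ on $\widetilde{\mathcal H}$ (so $\widetilde{\mathcal H}=\bigoplus_k\widetilde{\mathcal H}_k$ and the $k$-th state space is $\mathcal H(K_k)\oplus\widetilde{\mathcal H}_k$), and $U(f,0,e)=(f',0,e_*)$ whenever $(f,e)\in\mathcal D$ and $V(f,e)=(f',e_*)$. 1. Every GR-unitary colligation that realizes $S$ and is compatible with $\{K_k\}$ is unitarily equivalent to a unitary extension of $V$, for some $\widetilde{\mathcal H}$; and every unitary extension of $V$ realizes $S$ and is compatible with $\{K_k\}$. 2. For each $\widetilde{\mathcal H}$ the unitary extensions $U$ of $V$ on $\mathcal M\oplus\widetilde{\mathcal H}$ correspond bijectively to the GR-unitary colligations (loads) $\widetilde U=\begin{bmatrix}\widetilde U_{11}&\widetilde U_{12}\\\widetilde U_{21}&\widetilde U_{22}\end{bmatrix}$ with state space $\widetilde{\mathcal H}$, input space $\mathcal L$ and output space $\mathcal L'$, through the feedback connection: $U$ has the projections $P_k=P_k^{\mathcal M}\oplus\widetilde P_k$, where $P_k^{\mathcal M}$ is the projection of $\mathcal M$ onto $\mathcal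 H(K_k)$ and $\widetilde P_k$ are the projections of $\widetilde U$, and $U(h,\tilde h,e)=(h',\tilde h',e_*)$ if and only if there are uniquely determined $\ell\in\mathcal L$, $\ell'\in\mathcal L'$ with $U_0(h,e,\ell')=(h',e_*,\ell)$ and $\widetilde U(\tilde h,\ell)=(\tilde h',\ell')$. Explicitly, with $\mathcal F_\ell\left(\begin{bmatrix}\mathbf A&\mathbf B\\\mathbf C&\mathbf D\end{bmatrix},X\right)=\mathbf A+\mathbf B(I-X\mathbf D)^{-1}X\mathbf C$, $$U=\mathcal F_\ell\left(\left[\begin{array}{ccc|cc}U_{0,11}&0&U_{0,12}&0&U_{0,13}\\0&0&0&I&0\\U_{0,21}&0&U_{0,22}&0&U_{0,23}\\\hline0&I&0&0&0\\U_{0,31}&0&U_{0,32}&0&0\end{array}\right],\widetilde U\right)=\begin{bmatrix}U_{0,11}+U_{0,13}\widetilde U_{22}U_{0,31}&U_{0,13}\widetilde U_{21}&U_{0,12}+U_{0,13}\widetilde U_{22}U_{0,32}\\\widetilde U_{12}U_{0,31}&\widetilde U_{11}&\widetilde U_{12}U_{0,32}\\U_{0,21}+U_{0,23}\widetilde U_{22}U_{0,31}&U_{0,23}\widetilde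 U_{21}&U_{0,22}+U_{0,23}\widetilde U_{22}U_{0,32}\end{bmatrix}.$$ 3. If $\widetilde U$ and $U$ correspond to each other, then $\widetilde U$ is closely connected if and only if there is no nonzero closed subspace $M\subset\widetilde{\mathcal H}$ that $U$ maps onto itself and that is invariant under $P_1,\dots,P_d$. 4. If $\widetilde U,U$ and $\widetilde U',U'$ correspond to each other (with auxiliary spaces $\widetilde{\mathcal H}$ and $\widetilde{\mathcal H}'$), then $\widetilde U$ and $\widetilde U'$ are unitarily equivalent if and only if $U$ and $U'$ are unitarily equivalent via a unitary that is the identity on $\mathcal M$. -/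

import Mathlib

open scoped TensorProduct ContinuousLinearMap

noncomputable section

namespace GivoneRoesser

/-! ### Hilbert space direct sums and block operators -/

/-- The external Hilbert space direct sum of two Hilbert spaces. -/
abbrev HSum (X Y : Type*) : Type _ := WithLp 2 (X × Y)

/-- The column vector with entries `x` and `y`. -/
abbrev col {X Y : Type*} (x : X) (y : Y) : HSum X Y := WithLp.toLp 2 (x, y)

section Blocks

variable {X Y Z X' Y' Z' W W' : Type*}
  [NormedAddCommGroup X] [InnerProductSpace ℂ X] [NormedAddCommGroup Y] [InnerProductSpace ℂ Y]
  [NormedAddCommGroup Z] [InnerProductSpace ℂ Z]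
  [NormedAddCommGroup X'] [InnerProductSpace ℂ X'] [NormedAddCommGroup Y']
  [InnerProductSpace ℂ Y'] [NormedAddCommGroup Z'] [InnerProductSpace ℂ Z']
  [NormedAddCommGroup W] [InnerProductSpace ℂ W] [NormedAddCommGroup W'] [InnerProductSpace ℂ W']

/-- Inclusion of the first summand. -/
def inl (X Y : Type*) [NormedAddCommGroup X] [InnerProductSpace ℂ X]
    [NormedAddCommGroup Y] [InnerProductSpace ℂ Y] : X →L[ℂ] HSum X Y :=
  ((WithLp.prodContinuousLinearEquiv 2 ℂ X Y).symm : X × Y →L[ℂ] HSum X Y) ∘L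
    ContinuousLinearMap.inl ℂ X Y

/-- Inclusion of the second summand. -/
def inr (X Y : Type*) [NormedAddCommGroup X] [InnerProductSpace ℂ X]
    [NormedAddCommGroup Y] [InnerProductSpace ℂ Y] : Y →L[ℂ] HSum X Y :=
  ((WithLp.prodContinuousLinearEquiv 2 ℂ X Y).symm : X × Y →L[ℂ] HSum X Y) ∘L
    ContinuousLinearMap.inr ℂ X Y

/-- Projection onto the first summand. -/
def prl (X Y : Type*) [NormedAddCommGroup X] [InnerProductSpace ℂ X]
    [NormedAddCommGroup Y] [InnerProductSpace ℂ Y] : HSum X Y →L[ℂ] X :=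
  WithLp.fstL 2 ℂ X Y

/-- Projection onto the second summand. -/
def prr (X Y : Type*) [NormedAddCommGroup X] [InnerProductSpace ℂ X]
    [NormedAddCommGroup Y] [InnerProductSpace ℂ Y] : HSum X Y →L[ℂ] Y :=
  WithLp.sndL 2 ℂ X Y

/-- The operator with block matrix `[[a, b], [c, d]]`. -/
def block22 (a : X →L[ℂ] X') (b : Y →L[ℂ] X') (c : X →L[ℂ] Y') (d : Y →L[ℂ] Y') :
    HSum X Y →L[ℂ] HSum X' Y' :=
  inl X' Y' ∘L (a ∘L prl X Y + b ∘L prr X Y) + inr X' Y' ∘L (c ∘L prl X Y + d ∘L prr X Y)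

/-- The block row `[a, b]`. -/
def row (a : X →L[ℂ] X') (b : Y →L[ℂ] X') : HSum X Y →L[ℂ] X' :=
  a ∘L prl X Y + b ∘L prr X Y

/-- The block column with entries `a` and `c`. -/
def colOp (a : X →L[ℂ] X') (c : X →L[ℂ] Y') : X →L[ℂ] HSum X' Y' :=
  inl X' Y' ∘L a + inr X' Y' ∘L c

/-- The operator with the `3 × 3` block matrix whose rows are listed in order. -/
def block33 (a₁₁ : X →L[ℂ] X') (a₁₂ : Y →L[ℂ] X') (a₁₃ : Z →L[ℂ] X')
    (a₂₁ : X →L[ℂ] Y') (a₂₂ : Y →L[ℂ] Y') (a₂₃ : Z →L[ℂ] Y')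
    (a₃₁ : X →L[ℂ] Z') (a₃₂ : Y →L[ℂ] Z') (a₃₃ : Z →L[ℂ] Z') :
    HSum (HSum X Y) Z →L[ℂ] HSum (HSum X' Y') Z' :=
  block22 (block22 a₁₁ a₁₂ a₂₁ a₂₂) (colOp a₁₃ a₂₃) (row a₃₁ a₃₂) a₃₃

/-- The `(1,1)` block of an operator. -/
def blk11 (T : HSum X Y →L[ℂ] HSum X' Y') : X →L[ℂ] X' := prl X' Y' ∘L T ∘L inl X Y

/-- The `(1,2)` block of an operator. -/
def blk12 (T : HSum X Y →L[ℂ] HSum X' Y') : Y →L[ℂ] X' := prl X' Y' ∘L T ∘L inr X Y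

/-- The `(2,1)` block of an operator. -/
def blk21 (T : HSum X Y →L[ℂ] HSum X' Y') : X →L[ℂ] Y' := prr X' Y' ∘L T ∘L inl X Y

/-- The `(2,2)` block of an operator. -/
def blk22 (T : HSum X Y →L[ℂ] HSum X' Y') : Y →L[ℂ] Y' := prr X' Y' ∘L T ∘L inr X Y

/-- The lower Redheffer linear fractional map
`𝓕_ℓ([[A, B], [C, D]], T) = A + B (I - T D)⁻¹ T C`
(meaningful when `I - T D` is invertible). -/
def redheffer (A : X →L[ℂ] X') (B : W' →L[ℂ] X') (C : X →L[ℂ] W) (D : W' →L[ℂ] W)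
    (T : W →L[ℂ] W') : X →L[ℂ] X' :=
  A + B ∘L Ring.inverse (1 - T ∘L D) ∘L T ∘L C

/-! Feedback connection of `V = [V_{ij}]`, a `3 × 3` operator matrix with vanishing `(3,3)` entry,
with a load `T = [[T₁₁, T₁₂], [T₂₁, T₂₂]]`. -/

/-- The `(1,3)` block. -/
def blk13 (V : HSum (HSum X Y) Z →L[ℂ] HSum (HSum X' Y') Z') : Z →L[ℂ] X' :=
  prl X' Y' ∘L blk12 V

/-- The `(2,3)` block. -/
def blk23 (V : HSum (HSum X Y) Z →L[ℂ] HSum (HSum X' Y') Z') : Z →L[ℂ] Y' :=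
  prr X' Y' ∘L blk12 V

/-- The `(3,1)` block. -/
def blk31 (V : HSum (HSum X Y) Z →L[ℂ] HSum (HSum X' Y') Z') : X →L[ℂ] Z' :=
  blk21 V ∘L inl X Y

/-- The `(3,2)` block. -/
def blk32 (V : HSum (HSum X Y) Z →L[ℂ] HSum (HSum X' Y') Z') : Y →L[ℂ] Z' :=
  blk21 V ∘L inr X Y

/-- The Redheffer transform `𝓕_ℓ(M, T)` of the load `T`, where `M` is the operator matrix
`[[V₁₁, 0, V₁₂ | 0, V₁₃], [0, 0, 0 | I, 0], [V₂₁, 0, V₂₂ | 0, V₂₃],`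
`[0, I, 0 | 0, 0], [V₃₁, 0, V₃₂ | 0, 0]]`. -/
def redhefferParam (V : HSum (HSum X Y) Z →L[ℂ] HSum (HSum X' Y') Z')
    (T : HSum W Z' →L[ℂ] HSum W Z) : HSum (HSum X W) Y →L[ℂ] HSum (HSum X' W) Y' :=
  redheffer
    (block33
      (blk11 (blk11 V)) 0 (blk12 (blk11 V))
      0 0 0
      (blk21 (blk11 V)) 0 (blk22 (blk11 V)))
    (colOp (block22 0 (blk13 V) 1 0) (row 0 (blk23 V)))
    (block22 (row 0 1) 0 (row (blk31 V) 0) (blk32 V))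
    0 T

/-- The explicit `3 × 3` operator matrix in terms of the blocks of `V` and of the load `T`. -/
def explicitParam (V : HSum (HSum X Y) Z →L[ℂ] HSum (HSum X' Y') Z')
    (T : HSum W Z' →L[ℂ] HSum W Z) : HSum (HSum X W) Y →L[ℂ] HSum (HSum X' W) Y' :=
  block33
    (blk11 (blk11 V) + blk13 V ∘L blk22 T ∘L blk31 V)
    (blk13 V ∘L blk21 T)
    (blk12 (blk11 V) + blk13 V ∘L blk22 T ∘L blk32 V)
    (blk12 T ∘L blk31 V)
    (blk11 T)
    (blk12 T ∘L blk32 V)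
    (blk21 (blk11 V) + blk23 V ∘L blk22 T ∘L blk31 V)
    (blk23 V ∘L blk21 T)
    (blk22 (blk11 V) + blk23 V ∘L blk22 T ∘L blk32 V)

end Blocks

/-! ### Formal power series and formal Laurent series

A formal power series in `z = (z₁, …, z_d)` is its family of coefficients, indexed by
`Fin d →₀ ℕ`; a formal Laurent series is its family of coefficients, indexed by `Fin d → ℤ`. -/

/-- The Laurent coefficients of a formal power series (zero outside the nonnegative orthant). -/
def laurent {d : ℕ} {M : Type*} [Zero M] (a : (Fin d →₀ ℕ) → M) (n : Fin d → ℤ) : M :=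
  if ∀ k, 0 ≤ n k then a (Finsupp.equivFunOnFinite.symm fun k => (n k).toNat) else 0

/-- The `k`-th unit multi-index. -/
abbrev unitIdx {d : ℕ} (k : Fin d) : Fin d → ℤ := Pi.single k 1

/-- Kronecker delta `δ_{n,0}` as a scalar. -/
def delta {d : ℕ} (n : Fin d → ℤ) : ℂ := if n = 0 then 1 else 0

/-- A formal kernel `K(z,w) = ∑ K_{n,m} zⁿ w⁻ᵐ` with coefficients in `𝓛(F)`. It is a positive
kernel if it is positive semidefinite as an operator matrix. -/
abbrev FormalKernel (d : ℕ) (F : Type*) [NormedAddCommGroup F] [InnerProductSpace ℂ F] : Type _ :=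
  Matrix (Fin d → ℤ) (Fin d → ℤ) (F →L[ℂ] F)

section FRKHS

variable {d : ℕ} {F : Type*} [NormedAddCommGroup F] [InnerProductSpace ℂ F] [CompleteSpace F]

/-- The formal reproducing kernel Hilbert space `𝓗(K)` of a positive kernel `K`. An element `f` is
a formal Laurent series with coefficients `f n`, and `RKHS.kerFun (FRKHS K hK) m u` is the element
`[K]_m(z) u`. -/
def FRKHS (K : FormalKernel d F) (hK : K.PosSemidef) : Type _ :=
  haveI : Fact K.PosSemidef := ⟨hK⟩
  RKHS.OfKernel K

variable (K : FormalKernel d F) (hK : K.PosSemidef)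

instance : NormedAddCommGroup (FRKHS K hK) :=
  haveI : Fact K.PosSemidef := ⟨hK⟩
  inferInstanceAs (NormedAddCommGroup (RKHS.OfKernel K))

instance : InnerProductSpace ℂ (FRKHS K hK) :=
  haveI : Fact K.PosSemidef := ⟨hK⟩
  inferInstanceAs (InnerProductSpace ℂ (RKHS.OfKernel K))

instance : CompleteSpace (FRKHS K hK) :=
  haveI : Fact K.PosSemidef := ⟨hK⟩
  inferInstanceAs (CompleteSpace (RKHS.OfKernel K))

instance : RKHS ℂ (FRKHS K hK) (Fin d → ℤ) F :=
  haveI : Fact K.PosSemidef := ⟨hK⟩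
  inferInstanceAs (RKHS ℂ (RKHS.OfKernel K) (Fin d → ℤ) F)

theorem FRKHS.kernel_eq : RKHS.kernel (FRKHS K hK) = K :=
  haveI : Fact K.PosSemidef := ⟨hK⟩
  RKHS.OfKernel.kernel_ofKernel (K := K)

end FRKHS

/-! ### The Schur–Agler class and augmented Agler decompositions -/

section Agler

variable {d : ℕ} {E Es : Type*}
  [NormedAddCommGroup E] [InnerProductSpace ℂ E] [CompleteSpace E]
  [NormedAddCommGroup Es] [InnerProductSpace ℂ Es] [CompleteSpace Es]

/-- `S(z) = ∑ S_n zⁿ` is in the Schur–Agler class: the series converges on the unit polydisk, and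
`S(T) = ∑ S_n ⊗ Tⁿ` is a contraction from `E ⊗ 𝓚` to `E_* ⊗ 𝓚` for each commuting
`d`-tuple `T` of strict contractions on a Hilbert space `𝓚`. Contractivity is expressed on the
algebraic tensor product, which is dense in the Hilbert space tensor product. -/
def IsSchurAgler (S : (Fin d →₀ ℕ) → E →L[ℂ] Es) : Prop :=
  (∀ z : Fin d → ℂ, (∀ k, ‖z k‖ < 1) → Summable fun n : Fin d →₀ ℕ => (∏ k, z k ^ n k) • S n) ∧
  ∀ (𝓚 : Type) [NormedAddCommGroup 𝓚] [InnerProductSpace ℂ 𝓚] [CompleteSpace 𝓚]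
    (T : Fin d → 𝓚 →L[ℂ] 𝓚), (∀ j k, Commute (T j) (T k)) → (∀ k, ‖T k‖ < 1) →
    ∀ v : E ⊗[ℂ] 𝓚, ∃ y : UniformSpace.Completion (Es ⊗[ℂ] 𝓚),
      HasSum (fun n : Fin d →₀ ℕ =>
        ((TensorProduct.map (S n).toLinearMap (List.ofFn fun k => T k ^ n k).prod.toLinearMap v :
          Es ⊗[ℂ] 𝓚) : UniformSpace.Completion (Es ⊗[ℂ] 𝓚))) y ∧
      ‖y‖ ≤ ‖v‖

/-- An augmented Agler decomposition of the formal power series `S`: positive kernels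
`K₁, …, K_d` with coefficients in `𝓛(E_* ⊕ E)` such that
`[[I - S(z)S(w)^*, S(w) - S(z)], [S(z)^* - S(w)^*, S(z)^*S(w) - I]] = ∑ (1 - z_k w_k⁻¹) K_k(z,w)`,
with the convention `S(w)^* = ∑ S_n^* w⁻ⁿ`. As the formal version of a decomposition into
sesquianalytic kernels on the polydisk, `K_k(z,w) = H_k(z) H_k(w)^*` where the first component of
`H_k` is a power series in `z` and the second is `z_k⁻¹` times a power series in `z⁻¹`; this is
what the two support conditions say. -/
structure AugAglerDecomposition (S : (Fin d →₀ ℕ) → E →L[ℂ] Es) where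
  /-- The kernels. -/
  K : Fin d → FormalKernel d (HSum Es E)
  posSemidef : ∀ k, (K k).PosSemidef
  support_fst : ∀ k n m u, (¬ ∀ j, 0 ≤ n j) → (K k n m u).fst = 0
  support_snd : ∀ k n m u, (¬ ∀ j, (n + unitIdx k) j ≤ 0) → (K k n m u).snd = 0
  identity : ∀ (n m : Fin d → ℤ) (es : Es) (e : E),
    ∑ k, (K k n m - K k (n - unitIdx k) (m - unitIdx k)) (col es e) =
      col
        ((delta n * delta m) • es - laurent S n (ContinuousLinearMap.adjoint (laurent S m) es)
          + (delta n • laurent S (-m) e - delta m • laurent S n e))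
        ((delta m • ContinuousLinearMap.adjoint (laurent S (-n)) es
            - delta n • ContinuousLinearMap.adjoint (laurent S m) es)
          + (ContinuousLinearMap.adjoint (laurent S (-n)) (laurent S (-m) e)
            - (delta n * delta m) • e))

end Agler

/-! ### Givone–Roesser unitary colligations -/

/-- A GR-unitary colligation with state space `X`, input space `E` and output space `F`:
a unitary operator `U = [[A, B], [C, D]] : X ⊕ E → X ⊕ F`, together with orthogonal projections
`P₁, …, P_d` on `X` with pairwise orthogonal ranges that span `X`. -/
structure GRUnitary (d : ℕ) (X E F : Type*)
    [NormedAddCommGroup X] [InnerProductSpace ℂ X] [CompleteSpace X]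
    [NormedAddCommGroup E] [InnerProductSpace ℂ E]
    [NormedAddCommGroup F] [InnerProductSpace ℂ F] where
  /-- The projections. -/
  P : Fin d → X →L[ℂ] X
  isStarProjection : ∀ k, IsStarProjection (P k)
  orthogonal : ∀ j k, j ≠ k → P j ∘L P k = 0
  sum_eq_one : ∑ k, P k = 1
  /-- The colligation operator. -/
  U : HSum X E ≃ₗᵢ[ℂ] HSum X F

namespace GRUnitary

variable {d : ℕ} {X X' E F : Type*}
  [NormedAddCommGroup X] [InnerProductSpace ℂ X] [CompleteSpace X]
  [NormedAddCommGroup X'] [InnerProductSpace ℂ X'] [CompleteSpace X']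
  [NormedAddCommGroup E] [InnerProductSpace ℂ E] [CompleteSpace E]
  [NormedAddCommGroup F] [InnerProductSpace ℂ F] [CompleteSpace F]

/-- The colligation operator as a bounded operator. -/
def op (G : GRUnitary d X E F) : HSum X E →L[ℂ] HSum X F :=
  (G.U.toContinuousLinearEquiv : HSum X E →L[ℂ] HSum X F)

/-- State operator. -/
def A (G : GRUnitary d X E F) : X →L[ℂ] X := blk11 G.op

/-- Input operator. -/
def B (G : GRUnitary d X E F) : E →L[ℂ] X := blk12 G.op

/-- Output operator. -/
def C (G : GRUnitary d X E F) : X →L[ℂ] F := blk21 G.op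

/-- Feedthrough operator. -/
def D (G : GRUnitary d X E F) : E →L[ℂ] F := blk22 G.op

/-- The formal operator pencil `Z_diag(z) = z₁ P₁ + ⋯ + z_d P_d`. -/
def zDiag (G : GRUnitary d X E F) : MvPowerSeries (Fin d) (X →L[ℂ] X) :=
  ∑ k, MvPowerSeries.monomial (Finsupp.single k 1) (G.P k)

/-- The formal power series `(I - Z_diag(z) T)⁻¹`; the constant coefficient of `I - Z_diag(z) T` is
the identity, so this is the two-sided inverse. -/
def resolvent (G : GRUnitary d X E F) (T : X →L[ℂ] X) : MvPowerSeries (Fin d) (X →L[ℂ] X) :=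
  MvPowerSeries.invOfUnit (1 - G.zDiag * MvPowerSeries.C T) 1

/-- The colligation realizes `S`:
`S(z) = D + C (I - Z_diag(z) A)⁻¹ Z_diag(z) B` as formal power series. -/
def Realizes (G : GRUnitary d X E F) (S : (Fin d →₀ ℕ) → E →L[ℂ] F) : Prop :=
  ∀ n : Fin d →₀ ℕ,
    S n = (if n = 0 then G.D else 0) +
      G.C ∘L MvPowerSeries.coeff n (G.resolvent G.A * G.zDiag) ∘L G.B

/-- The coefficient of `zⁿ` in the formal Laurent series
`H_k(z) = [C (I - Z_diag(z) A)⁻¹ ; z_k⁻¹ B^* (I - Z_diag(z)⁻¹ A^*)⁻¹] P_k`. -/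
def kernelFactor (G : GRUnitary d X E F) (k : Fin d) (n : Fin d → ℤ) : X →L[ℂ] HSum F E :=
  colOp
    (G.C ∘L laurent (fun j => MvPowerSeries.coeff j (G.resolvent G.A)) n ∘L G.P k)
    (ContinuousLinearMap.adjoint G.B ∘L
      laurent (fun j => MvPowerSeries.coeff j (G.resolvent (ContinuousLinearMap.adjoint G.A)))
        (-(n + unitIdx k)) ∘L G.P k)

/-- The colligation is compatible with the kernels `K₁, …, K_d`:
`K_k(z,w) = H_k(z) H_k(w)^*` for the series `H_k` of `kernelFactor`. -/
def Compatible (G : GRUnitary d X E F) (K : Fin d → FormalKernel d (HSum F E)) : Prop :=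
  ∀ k n m, K k n m =
    G.kernelFactor k n ∘L ContinuousLinearMap.adjoint (G.kernelFactor k m)

/-- The colligation is closely connected: the smallest closed subspace of the state space that
contains `im B` and `im C^*` and is invariant for `A`, `A^*` and each `P_k` is the whole space. -/
def CloselyConnected (G : GRUnitary d X E F) : Prop :=
  ∀ M : Submodule ℂ X, IsClosed (M : Set X) →
    (∀ e, G.B e ∈ M) → (∀ f, ContinuousLinearMap.adjoint G.C f ∈ M) →
    (∀ x ∈ M, G.A x ∈ M) → (∀ x ∈ M, ContinuousLinearMap.adjoint G.A x ∈ M) →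
    (∀ k, ∀ x ∈ M, G.P k x ∈ M) → M = ⊤

/-- The unitary operator `ω` between the state spaces is a unitary equivalence of colligations:
it intertwines the projections, and `U' (ω ⊕ I) = (ω ⊕ I) U`. -/
def EquivVia (ω : X ≃ₗᵢ[ℂ] X') (G : GRUnitary d X E F) (G' : GRUnitary d X' E F) : Prop :=
  (∀ k x, ω (G.P k x) = G'.P k (ω x)) ∧
  ∀ x e, G'.U (col (ω x) e) = col (ω (G.U (col x e)).fst) (G.U (col x e)).snd

/-- Unitary equivalence of colligations. -/
def UnitarilyEquivalent (G : GRUnitary d X E F) (G' : GRUnitary d X' E F) : Prop :=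
  ∃ ω : X ≃ₗᵢ[ℂ] X', EquivVia ω G G'

end GRUnitary

/-! ### The canonical partial isometry and the overlapping spaces -/

namespace AugAglerDecomposition

variable {d : ℕ} {E Es : Type*}
  [NormedAddCommGroup E] [InnerProductSpace ℂ E] [CompleteSpace E]
  [NormedAddCommGroup Es] [InnerProductSpace ℂ Es] [CompleteSpace Es]
  {S : (Fin d →₀ ℕ) → E →L[ℂ] Es} (𝒦 : AugAglerDecomposition S)

/-- The space `𝓗(K_k)`. -/
abbrev H (k : Fin d) : Type _ := FRKHS (𝒦.K k) (𝒦.posSemidef k)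

/-- The external direct sum `𝓗(K₁) ⊕ ⋯ ⊕ 𝓗(K_d)`. -/
abbrev Model : Type _ := PiLp 2 fun k => 𝒦.H k

/-- The vector with components `[K₁]_m(z) u, …, [K_d]_m(z) u` and
`[S_m^*  δ_{m,0} I] u`. -/
def genD (m : Fin d → ℤ) (u : HSum Es E) : HSum 𝒦.Model E :=
  col (WithLp.toLp 2 fun k => RKHS.kerFun (𝒦.H k) m u)
    (ContinuousLinearMap.adjoint (laurent S m) u.fst + delta m • u.snd)

/-- The vector with components `[K₁]_{m-e₁}(z) u, …, [K_d]_{m-e_d}(z) u` and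
`[δ_{m,0} I  S_{-m}] u`. -/
def genR (m : Fin d → ℤ) (u : HSum Es E) : HSum 𝒦.Model Es :=
  col (WithLp.toLp 2 fun k => RKHS.kerFun (𝒦.H k) (m - unitIdx k) u)
    (delta m • u.fst + laurent S (-m) u.snd)

/-- The closed subspace `𝓓`. -/
def domD : Submodule ℂ (HSum 𝒦.Model E) :=
  (Submodule.span ℂ (Set.range fun p : (Fin d → ℤ) × HSum Es E =>
    𝒦.genD p.1 p.2)).topologicalClosure

/-- The closed subspace `𝓡`. -/
def ranR : Submodule ℂ (HSum 𝒦.Model Es) :=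
  (Submodule.span ℂ (Set.range fun p : (Fin d → ℤ) × HSum Es E =>
    𝒦.genR p.1 p.2)).topologicalClosure

theorem genD_mem (m : Fin d → ℤ) (u : HSum Es E) : 𝒦.genD m u ∈ 𝒦.domD :=
  Submodule.le_topologicalClosure _ (Submodule.subset_span ⟨(m, u), rfl⟩)

theorem genR_mem (m : Fin d → ℤ) (u : HSum Es E) : 𝒦.genR m u ∈ 𝒦.ranR :=
  Submodule.le_topologicalClosure _ (Submodule.subset_span ⟨(m, u), rfl⟩)

/-- The defining property of the unitary operator `V : 𝓓 → 𝓡`. -/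
def IsV (V : 𝒦.domD ≃ₗᵢ[ℂ] 𝒦.ranR) : Prop :=
  ∀ m u, V ⟨𝒦.genD m u, 𝒦.genD_mem m u⟩ = ⟨𝒦.genR m u, 𝒦.genR_mem m u⟩

/-- The sum map `(f₁, …, f_d) ↦ f₁(z) + ⋯ + f_d(z)`, into the formal Laurent series. -/
def sumMap : 𝒦.Model →L[ℂ] ((Fin d → ℤ) → HSum Es E) :=
  ∑ k, RKHS.coeCLM ℂ ∘L PiLp.proj 2 𝒦.H k

/-- The map `(f₁, …, f_d) ↦ z₁ f₁(z) + ⋯ + z_d f_d(z)`, into the formal Laurent series. -/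
def shiftedSumMap : 𝒦.Model →L[ℂ] ((Fin d → ℤ) → HSum Es E) :=
  ∑ k, (ContinuousLinearMap.pi fun n => ContinuousLinearMap.proj (n - unitIdx k)) ∘L
    RKHS.coeCLM ℂ ∘L PiLp.proj 2 𝒦.H k

/-- The overlapping space `𝓛(K₁, …, K_d)`. -/
def L : Submodule ℂ 𝒦.Model := 𝒦.sumMap.toLinearMap.ker

/-- The overlapping space `𝓛(K'₁, …, K'_d)` of the kernels `K'_k(z,w) = z_k K_k(z,w) w_k⁻¹`, with
`𝓗(K'_k) = z_k 𝓗(K_k)` identified with `𝓗(K_k)` through multiplication by `z_k⁻¹`. -/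
def L' : Submodule ℂ 𝒦.Model := 𝒦.shiftedSumMap.toLinearMap.ker

instance : CompleteSpace 𝒦.L :=
  inferInstanceAs (CompleteSpace (𝒦.sumMap.toLinearMap.ker))

instance : CompleteSpace 𝒦.L' :=
  inferInstanceAs (CompleteSpace (𝒦.shiftedSumMap.toLinearMap.ker))

/-- The defining properties of the unitary operator
`U₀ : (⊕ 𝓗(K_k)) ⊕ E ⊕ 𝓛' → (⊕ 𝓗(K_k)) ⊕ E_* ⊕ 𝓛`. -/
def IsU₀ (V : 𝒦.domD ≃ₗᵢ[ℂ] 𝒦.ranR)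
    (U₀ : HSum (HSum 𝒦.Model E) 𝒦.L' ≃ₗᵢ[ℂ] HSum (HSum 𝒦.Model Es) 𝒦.L) : Prop :=
  (∀ x : 𝒦.domD, U₀ (col (x : HSum 𝒦.Model E) 0) = col (V x : HSum 𝒦.Model Es) 0) ∧
  (∀ l : 𝒦.L, U₀ (col (col (l : 𝒦.Model) 0) 0) = col 0 l) ∧
  (∀ l' : 𝒦.L', U₀ (col 0 l') = col (col (l' : 𝒦.Model) 0) 0)

section Extensions

variable {𝒦} {Ht : Type*} [NormedAddCommGroup Ht] [InnerProductSpace ℂ Ht] [CompleteSpace Ht]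

/-- The colligation `G`, on the state space `(⊕ 𝓗(K_k)) ⊕ Ht`, is a unitary extension of `V`:
its `k`-th projection is the direct sum of the projection of `⊕ 𝓗(K_k)` onto `𝓗(K_k)` and an
operator on `Ht` (so that its `k`-th state space is `𝓗(K_k) ⊕ Ht_k`), and its operator agrees with
`V` on `𝓓`. -/
def IsExtension (V : 𝒦.domD ≃ₗᵢ[ℂ] 𝒦.ranR) (G : GRUnitary d (HSum 𝒦.Model Ht) E Es) : Prop :=
  (∃ Pt : Fin d → Ht →L[ℂ] Ht, ∀ k h ht,
    G.P k (col h ht) = col (PiLp.single 2 k (h k)) (Pt k ht)) ∧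
  ∀ x : 𝒦.domD,
    G.U (col (col (x : HSum 𝒦.Model E).fst 0) (x : HSum 𝒦.Model E).snd) =
      col (col (V x : HSum 𝒦.Model Es).fst 0) (V x : HSum 𝒦.Model Es).snd

/-- `G` is the feedback connection of `U₀` with the load `Gt`: the projections of `G` are the direct
sums of those of `⊕ 𝓗(K_k)` and of `Gt`, and `G` maps `(h, ht, e)` to `(h', ht', es)` if and only
if there are uniquely determined `l`, `l'` such that `U₀` maps `(h, e, l')` to `(h', es, l)` and
`Gt` maps `(ht, l)` to `(ht', l')`. -/
def IsFeedback (U₀ : HSum (HSum 𝒦.Model E) 𝒦.L' ≃ₗᵢ[ℂ] HSum (HSum 𝒦.Model Es) 𝒦.L)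
    (Gt : GRUnitary d Ht 𝒦.L 𝒦.L') (G : GRUnitary d (HSum 𝒦.Model Ht) E Es) : Prop :=
  (∀ k h ht, G.P k (col h ht) = col (PiLp.single 2 k (h k)) (Gt.P k ht)) ∧
  ∀ h ht e h' ht' es,
    G.U (col (col h ht) e) = col (col h' ht') es ↔
      ∃! l : 𝒦.L × 𝒦.L', U₀ (col (col h e) l.2) = col (col h' es) l.1 ∧
        Gt.U (col ht l.1) = col ht' l.2

end Extensions

section Feedback

variable {𝒦}
variable (U₀ : HSum (HSum 𝒦.Model E) 𝒦.L' ≃ₗᵢ[ℂ] HSum (HSum 𝒦.Model Es) 𝒦.L)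

/-- `U₀` as a bounded operator. -/
def opU₀ : HSum (HSum 𝒦.Model E) 𝒦.L' →L[ℂ] HSum (HSum 𝒦.Model Es) 𝒦.L :=
  (U₀.toContinuousLinearEquiv :
    HSum (HSum 𝒦.Model E) 𝒦.L' →L[ℂ] HSum (HSum 𝒦.Model Es) 𝒦.L)

end Feedback

end AugAglerDecomposition

end GivoneRoesser

end

open GivoneRoesser

universe u v w

/-!
The support conditions on the kernels force the orthogonal complement of `𝓓` to be `𝓛 ⊕ 0` and that
of `𝓡` to be `𝓛' ⊕ 0`: at multi-index `0` no element of `𝓗(K_k)` contributes to the input,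
respectively output, component, so this component of a vector orthogonal to all generators vanishes
(`mem_domD_orthogonal`, `mem_ranR_orthogonal`). The identity of the decomposition says exactly that
the two families of generators have the same Gram matrix (`inner_genD_genD`), which gives `V`. Hence
there are unitary identifications `Φ : 𝓓 ⊕ 𝓛 → 𝓜 ⊕ E` and `Ψ : 𝓡 ⊕ 𝓛' → 𝓜 ⊕ E_*`, and `U₀` is
`(Φ (x, l), l') ↦ (Ψ (V x, l'), l)` (`swapUnitary`).

In these coordinates the feedback connection with a load `T` is the unitary operator
`(x, (w, l)) ↦ (V x, T (w, l))`, that is, `V` on `𝓓` plus the load on `W ⊕ 𝓛` (`feedback`). So a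
unitary operator on `𝓜 ⊕ W ⊕ E` that extends `V` is the feedback connection with a unique load
(`exists_eq_feedback`), and all statements about loads are read off from this orthogonal
decomposition. This part works for any Hilbert space `M` and subspaces `D`, `R`, `L`, `L'` with
`Dᗮ = L ⊕ 0` and `Rᗮ = L' ⊕ 0`.

Realizations are handled through recursions. For the vectors `x_m(u) = ∑ k, (H_k)_m^* u` built from
a colligation, realizing `S` is equivalent to
`U (x_m(u), S_m^* u₁ + δ u₂) = (∑ k, P_k x_{m - e_k}(u), δ u₁ + S_{-m} u₂)`
(`Realizes.apply_generator`). Conversely any family satisfying this relation together with the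
support conditions is the one built from the colligation, because each of the two recursions that it
encodes, for `u₁` in powers of `z` and for `u₂` in powers of `z⁻¹`, has only one solution supported
in the nonnegative orthant (`realizes_of_apply_generator`, `eq_of_recursion`). A unitary extension
of `V` satisfies the relation with `x_m(u) = ([K_k]_m u)_k`. For a compatible realization
`[K_k]_m u ↦ (H_k)_m^* u` is an isometry of `𝓗(K_k)` into the `k`-th state space by comparison of
Gram matrices, and the orthogonal complement of the image of `𝓜` is the auxiliary space
(`exists_isExtension`).
-/

noncomputable section

namespace GivoneRoesser

local notation "⟪" x ", " y "⟫" => inner ℂ x y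

/-! ### Column vectors and Gram matrices -/

theorem col_add_col {X Y : Type*} [NormedAddCommGroup X] [NormedAddCommGroup Y]
    (x x' : X) (y y' : Y) : col x y + col x' y' = col (x + x') (y + y') := rfl

theorem col_eta {X Y : Type*} (z : HSum X Y) : col z.fst z.snd = z := rfl

theorem eq_zero_col {X Y : Type*} [Zero X] {z : HSum X Y} (h : z.fst = 0) : z = col 0 z.snd := by
  rw [← h, col_eta]

theorem eq_col_zero {X Y : Type*} [Zero Y] {z : HSum X Y} (h : z.snd = 0) : z = col z.fst 0 := by
  rw [← h, col_eta]

theorem smul_col {X Y : Type*} [NormedAddCommGroup X] [NormedSpace ℂ X] [NormedAddCommGroup Y]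
    [NormedSpace ℂ Y] (c : ℂ) (x : X) (y : Y) : c • col x y = col (c • x) (c • y) := rfl

theorem col_inj {X Y : Type*} {x x' : X} {y y' : Y} :
    col x y = col x' y' ↔ x = x' ∧ y = y' := by
  simp

theorem norm_col_sq {X Y : Type*} [NormedAddCommGroup X] [NormedAddCommGroup Y] (x : X) (y : Y) :
    ‖col x y‖ ^ 2 = ‖x‖ ^ 2 + ‖y‖ ^ 2 :=
  WithLp.prod_norm_sq_eq_of_L2 _

theorem sum_col {X Y ι : Type*} [NormedAddCommGroup X] [NormedAddCommGroup Y] (s : Finset ι)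
    (f : ι → X) (g : ι → Y) : ∑ i ∈ s, col (f i) (g i) = col (∑ i ∈ s, f i) (∑ i ∈ s, g i) := by
  classical
  induction s using Finset.induction_on with
  | empty => rfl
  | insert i s hi ih =>
    rw [Finset.sum_insert hi, Finset.sum_insert hi, Finset.sum_insert hi, ih, col_add_col]

section Hilbert

variable {X Y X' Y' : Type*}
  [NormedAddCommGroup X] [InnerProductSpace ℂ X] [NormedAddCommGroup Y] [InnerProductSpace ℂ Y]
  [NormedAddCommGroup X'] [InnerProductSpace ℂ X'] [NormedAddCommGroup Y'] [InnerProductSpace ℂ Y']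

theorem inner_col (x x' : X) (y y' : Y) : ⟪col x y, col x' y'⟫ = ⟪x, x'⟫ + ⟪y, y'⟫ :=
  WithLp.prod_inner_apply _ _

theorem inner_eq_fst_add_snd (z z' : HSum X Y) :
    ⟪z, z'⟫ = ⟪z.fst, z'.fst⟫ + ⟪z.snd, z'.snd⟫ :=
  WithLp.prod_inner_apply _ _

theorem inner_col_right (v : HSum X Y) (a : X) (b : Y) :
    ⟪v, col a b⟫ = ⟪v.fst, a⟫ + ⟪v.snd, b⟫ := inner_eq_fst_add_snd v _

theorem inner_col_zero_left (x : X) (z : HSum X Y) : ⟪col x 0, z⟫ = ⟪x, z.fst⟫ := by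
  rw [← col_eta z, inner_col, inner_zero_left, add_zero]
  rfl

theorem inner_zero_col_left (y : Y) (z : HSum X Y) : ⟪col 0 y, z⟫ = ⟪y, z.snd⟫ := by
  rw [← col_eta z, inner_col, inner_zero_left, zero_add]
  rfl

theorem block22_col (a : X →L[ℂ] X') (b : Y →L[ℂ] X') (c : X →L[ℂ] Y') (d : Y →L[ℂ] Y')
    (x : X) (y : Y) : block22 a b c d (col x y) = col (a x + b y) (c x + d y) := by
  simp [block22, inl, inr, prl, prr, col_add_col]

theorem row_col (a : X →L[ℂ] X') (b : Y →L[ℂ] X') (x : X) (y : Y) :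
    row a b (col x y) = a x + b y := rfl

theorem colOp_apply (a : X →L[ℂ] X') (c : X →L[ℂ] Y') (x : X) :
    colOp a c x = col (a x) (c x) := by
  simp [colOp, inl, inr, col_add_col]

theorem blk11_apply (T : HSum X Y →L[ℂ] HSum X' Y') (x : X) : blk11 T x = (T (col x 0)).fst := rfl
theorem blk12_apply (T : HSum X Y →L[ℂ] HSum X' Y') (y : Y) : blk12 T y = (T (col 0 y)).fst := rfl
theorem blk21_apply (T : HSum X Y →L[ℂ] HSum X' Y') (x : X) : blk21 T x = (T (col x 0)).snd := rfl
theorem blk22_apply (T : HSum X Y →L[ℂ] HSum X' Y') (y : Y) : blk22 T y = (T (col 0 y)).snd := rfl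

theorem colOp_adjoint_apply [CompleteSpace X] [CompleteSpace X'] [CompleteSpace Y']
    (a : X →L[ℂ] X') (c : X →L[ℂ] Y') (u : HSum X' Y') :
    ContinuousLinearMap.adjoint (colOp a c) u =
      ContinuousLinearMap.adjoint a u.fst + ContinuousLinearMap.adjoint c u.snd := by
  refine ext_inner_right ℂ fun x => ?_
  rw [ContinuousLinearMap.adjoint_inner_left, inner_add_left,
    ContinuousLinearMap.adjoint_inner_left, ContinuousLinearMap.adjoint_inner_left, colOp_apply]
  exact inner_col u.fst _ u.snd _

/-- A family with dense span can be mapped isometrically onto any family with the same Gram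
matrix. -/
theorem exists_isometry_of_gram {ι : Type*} [CompleteSpace Y] {g : ι → X} {g' : ι → Y}
    (hg : (Submodule.span ℂ (Set.range g)).topologicalClosure = ⊤)
    (h : ∀ i j, ⟪g i, g j⟫ = ⟪g' i, g' j⟫) : ∃ V : X →ₗᵢ[ℂ] Y, ∀ i, V (g i) = g' i := by
  let T := Finsupp.linearCombination ℂ g
  let T' := Finsupp.linearCombination ℂ g'
  have hT : DenseRange T := by
    have h1 : Dense ((Submodule.span ℂ (Set.range g) : Submodule ℂ X) : Set X) := by
      rwa [Submodule.dense_iff_topologicalClosure_eq_top]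
    rw [← Finsupp.range_linearCombination] at h1
    simpa only [DenseRange, T, LinearMap.coe_range] using h1
  have hn : ∀ x, ‖T' x‖ = ‖T x‖ := by
    intro x
    have hin : ⟪T' x, T' x⟫ = ⟪T x, T x⟫ := by
      simp only [T, T', Finsupp.linearCombination_apply, Finsupp.sum_inner, Finsupp.inner_sum, h,
        inner_smul_left, inner_smul_right]
    rw [inner_self_eq_norm_sq_to_K, inner_self_eq_norm_sq_to_K] at hin
    have h2 : ‖T' x‖ ^ 2 = ‖T x‖ ^ 2 := by exact_mod_cast hin
    exact (sq_eq_sq₀ (norm_nonneg _) (norm_nonneg _)).1 h2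
  have hb : ∃ C : ℝ, ∀ x, ‖T' x‖ ≤ C * ‖T x‖ := ⟨1, fun x => by rw [hn, one_mul]⟩
  let W : X →L[ℂ] Y := T'.extendOfNorm T
  have hW : ∀ x, W (T x) = T' x := fun x => LinearMap.extendOfNorm_eq hT hb x
  refine ⟨⟨W.toLinearMap, fun x => ?_⟩, fun i => ?_⟩
  · refine hT.induction_on (p := fun x => ‖W x‖ = ‖x‖) x
      (isClosed_eq (by fun_prop) (by fun_prop)) fun y => ?_
    rw [hW, hn]
  · have := hW (Finsupp.single i 1)
    simpa [T, T'] using this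

theorem topologicalClosure_span_eq_top {ι : Type*} (g : ι → X)
    (hmem : ∀ i, g i ∈ (Submodule.span ℂ (Set.range g)).topologicalClosure) :
    (Submodule.span ℂ (Set.range fun i =>
      (⟨g i, hmem i⟩ : (Submodule.span ℂ (Set.range g)).topologicalClosure))).topologicalClosure
      = ⊤ := by
  set D := (Submodule.span ℂ (Set.range g)).topologicalClosure
  rw [← Submodule.dense_iff_topologicalClosure_eq_top]
  intro x
  rw [closure_subtype]
  have hx : (x : X) ∈ closure ((Submodule.span ℂ (Set.range g) : Submodule ℂ X) : Set X) := by
    have := x.2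
    rwa [← SetLike.mem_coe, Submodule.topologicalClosure_coe] at this
  have : ((↑) '' ((Submodule.span ℂ (Set.range fun i => (⟨g i, hmem i⟩ : D)) :
      Submodule ℂ D) : Set D) : Set X) = (Submodule.span ℂ (Set.range g) : Submodule ℂ X) := by
    have h2 := Submodule.map_span D.subtype (Set.range fun i => (⟨g i, hmem i⟩ : D))
    rw [← Set.range_comp] at h2
    exact congrArg (fun M : Submodule ℂ X => (M : Set X)) h2
  rwa [this]

theorem eq_of_eqOn_generators {ι : Type*} {g : ι → X}
    (hg : (Submodule.span ℂ (Set.range g)).topologicalClosure = ⊤) {f f' : X →L[ℂ] Y}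
    (h : ∀ i, f (g i) = f' (g i)) : f = f' := by
  refine ContinuousLinearMap.ext_on (s := Set.range g)
    ((Submodule.dense_iff_topologicalClosure_eq_top).2 hg) ?_
  rintro _ ⟨i, rfl⟩
  exact h i

theorem mem_orthogonal_topologicalClosure_span_iff {ι : Type*} (g : ι → X) {x : X} :
    x ∈ (Submodule.span ℂ (Set.range g)).topologicalClosureᗮ ↔ ∀ i, ⟪g i, x⟫ = 0 := by
  rw [Submodule.orthogonal_closure]
  constructor
  · exact fun h i => h _ (Submodule.subset_span ⟨i, rfl⟩)
  · intro h
    rw [Submodule.mem_orthogonal]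
    intro y hy
    induction hy using Submodule.span_induction with
    | mem y hy => obtain ⟨i, rfl⟩ := hy; exact h _
    | zero => exact inner_zero_left _
    | add y z _ _ hy hz => rw [inner_add_left, hy, hz, add_zero]
    | smul c y _ hy => rw [inner_smul_left, hy, mul_zero]

/-- Two families with the same Gram matrix have unitarily equivalent closed spans, through a unique
unitary operator matching the families. -/
theorem existsUnique_unitary_of_gram {ι : Type*} [CompleteSpace X] [CompleteSpace Y]
    (g : ι → X) (g' : ι → Y) (h : ∀ i j, ⟪g i, g j⟫ = ⟪g' i, g' j⟫)
    (hmem : ∀ i, g i ∈ (Submodule.span ℂ (Set.range g)).topologicalClosure)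
    (hmem' : ∀ i, g' i ∈ (Submodule.span ℂ (Set.range g')).topologicalClosure) :
    ∃! V : (Submodule.span ℂ (Set.range g)).topologicalClosure ≃ₗᵢ[ℂ]
      (Submodule.span ℂ (Set.range g')).topologicalClosure,
      ∀ i, V ⟨g i, hmem i⟩ = ⟨g' i, hmem' i⟩ := by
  have hd := topologicalClosure_span_eq_top g hmem
  have hd' := topologicalClosure_span_eq_top g' hmem'
  have c1 : CompleteSpace (Submodule.span ℂ (Set.range g)).topologicalClosure :=
    (Submodule.isClosed_topologicalClosure _).completeSpace_coe
  have c2 : CompleteSpace (Submodule.span ℂ (Set.range g')).topologicalClosure :=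
    (Submodule.isClosed_topologicalClosure _).completeSpace_coe
  set D := (Submodule.span ℂ (Set.range g)).topologicalClosure
  set R := (Submodule.span ℂ (Set.range g')).topologicalClosure
  obtain ⟨V, hV⟩ := exists_isometry_of_gram
    (g := fun i => (⟨g i, hmem i⟩ : D)) (g' := fun i => (⟨g' i, hmem' i⟩ : R)) hd
    (fun i j => h i j)
  obtain ⟨W, hW⟩ := exists_isometry_of_gram
    (g := fun i => (⟨g' i, hmem' i⟩ : R)) (g' := fun i => (⟨g i, hmem i⟩ : D)) hd'
    (fun i j => (h i j).symm)
  have hVW : V.toContinuousLinearMap ∘L W.toContinuousLinearMap = .id ℂ R :=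
    eq_of_eqOn_generators hd' fun i => by
      simp only [ContinuousLinearMap.comp_apply, LinearIsometry.coe_toContinuousLinearMap, hV, hW]
      rfl
  refine ⟨LinearIsometryEquiv.ofSurjective V fun y => ⟨W y, DFunLike.congr_fun hVW y⟩, hV, ?_⟩
  intro V' hV'
  have h1 : (V'.toContinuousLinearEquiv : D →L[ℂ] R) = V.toContinuousLinearMap :=
    eq_of_eqOn_generators hd fun i => (hV' i).trans (hV i).symm
  exact LinearIsometryEquiv.ext fun x => DFunLike.congr_fun h1 x

/-- A unitary operator that maps the range of an isometry onto the range of another one restricts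
to a unitary operator. -/
theorem exists_restrict (J : X →ₗᵢ[ℂ] X') (J' : Y →ₗᵢ[ℂ] Y') (U : X' ≃ₗᵢ[ℂ] Y')
    (h : ∀ x, ∃ y, U (J x) = J' y) (h' : ∀ y, ∃ x, U (J x) = J' y) :
    ∃ T : X ≃ₗᵢ[ℂ] Y, ∀ x, U (J x) = J' (T x) := by
  choose T hT using h
  let T₀ : X →ₗᵢ[ℂ] Y :=
    { toFun := T
      map_add' := fun x y => J'.injective (by simp [← hT])
      map_smul' := fun c x => J'.injective (by simp [← hT])
      norm_map' := fun x => by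
        change ‖T x‖ = ‖x‖
        rw [← J'.norm_map, ← hT, U.norm_map, J.norm_map] }
  refine ⟨LinearIsometryEquiv.ofSurjective T₀ fun y => ?_, hT⟩
  obtain ⟨x, hx⟩ := h' y
  exact ⟨x, J'.injective ((hT x).symm.trans hx)⟩

end Hilbert

/-! ### Feedback connections of unitary operators -/

section Feedback

variable {X Y Z W M E F D R L L' : Type*}
  [NormedAddCommGroup X] [InnerProductSpace ℂ X] [NormedAddCommGroup Y] [InnerProductSpace ℂ Y]
  [NormedAddCommGroup Z] [InnerProductSpace ℂ Z] [NormedAddCommGroup W] [InnerProductSpace ℂ W]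
  [NormedAddCommGroup M] [InnerProductSpace ℂ M]
  [NormedAddCommGroup E] [InnerProductSpace ℂ E] [NormedAddCommGroup F] [InnerProductSpace ℂ F]
  [NormedAddCommGroup D] [InnerProductSpace ℂ D] [NormedAddCommGroup R] [InnerProductSpace ℂ R]
  [NormedAddCommGroup L] [InnerProductSpace ℂ L] [NormedAddCommGroup L'] [InnerProductSpace ℂ L']

/-- The identification of a Hilbert space with the external direct sum of two orthogonal
subspaces, given as ranges of isometries, that together span it. -/
def orthogonalSum (J : X →ₗᵢ[ℂ] Z) (J' : Y →ₗᵢ[ℂ] Z) (h : ∀ x y, ⟪J x, J' y⟫ = 0)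
    (hs : ∀ z, ∃ x y, z = J x + J' y) : HSum X Y ≃ₗᵢ[ℂ] Z :=
  LinearIsometryEquiv.ofSurjective
    { toLinearMap := (row J.toContinuousLinearMap J'.toContinuousLinearMap).toLinearMap
      norm_map' := fun z => by
        obtain ⟨x, y⟩ := z
        have h1 : ‖J x + J' y‖ ^ 2 = ‖col x y‖ ^ 2 := by
          rw [pow_two, norm_add_sq_eq_norm_sq_add_norm_sq_of_inner_eq_zero (𝕜 := ℂ) _ _ (h x y),
            ← pow_two, ← pow_two, norm_col_sq, J.norm_map, J'.norm_map]
        exact (sq_eq_sq₀ (norm_nonneg _) (norm_nonneg _)).1 h1 }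
    fun z => by
      obtain ⟨x, y, rfl⟩ := hs z
      exact ⟨col x y, rfl⟩

theorem orthogonalSum_col (J : X →ₗᵢ[ℂ] Z) (J' : Y →ₗᵢ[ℂ] Z) (h : ∀ x y, ⟪J x, J' y⟫ = 0)
    (hs : ∀ z, ∃ x y, z = J x + J' y) (x : X) (y : Y) :
    orthogonalSum J J' h hs (col x y) = J x + J' y := rfl

/-- The unitary operator `(x, l, l') ↦ (V x, l', l)` from `(D ⊕ L) ⊕ L'` to `(R ⊕ L') ⊕ L`, where
`D ⊕ L` and `R ⊕ L'` are identified with `X` and `Y`. -/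
def swapUnitary (Φ : HSum D L ≃ₗᵢ[ℂ] X) (Ψ : HSum R L' ≃ₗᵢ[ℂ] Y) (V : D ≃ₗᵢ[ℂ] R) :
    HSum X L' ≃ₗᵢ[ℂ] HSum Y L where
  toFun z := col (Ψ (col (V (Φ.symm z.fst).fst) z.snd)) (Φ.symm z.fst).snd
  invFun z := col (Φ (col (V.symm (Ψ.symm z.fst).fst) z.snd)) (Ψ.symm z.fst).snd
  map_add' z z' := by
    simp only [WithLp.add_fst, WithLp.add_snd, map_add, ← col_add_col]
  map_smul' c z := by
    simp only [WithLp.smul_fst, WithLp.smul_snd, map_smul, ← smul_col, RingHom.id_apply]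
  left_inv z := by simp [col_eta]
  right_inv z := by simp [col_eta]
  norm_map' z := by
    obtain ⟨x, l'⟩ := z
    obtain ⟨⟨d, l⟩, rfl⟩ := Φ.surjective x
    refine (sq_eq_sq₀ (norm_nonneg _) (norm_nonneg _)).1 ?_
    change ‖col (Ψ (col (V (Φ.symm (Φ (col d l))).fst) l')) (Φ.symm (Φ (col d l))).snd‖ ^ 2 =
      ‖col (Φ (col d l)) l'‖ ^ 2
    simp only [LinearIsometryEquiv.symm_apply_apply, norm_col_sq, LinearIsometryEquiv.norm_map,
      WithLp.toLp_fst, WithLp.toLp_snd]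
    ring

theorem swapUnitary_col (Φ : HSum D L ≃ₗᵢ[ℂ] X) (Ψ : HSum R L' ≃ₗᵢ[ℂ] Y) (V : D ≃ₗᵢ[ℂ] R)
    (x : D) (l : L) (l' : L') :
    swapUnitary Φ Ψ V (col (Φ (col x l)) l') = col (Ψ (col (V x) l')) l := by
  change col (Ψ (col (V (Φ.symm (Φ (col x l))).fst) l')) (Φ.symm (Φ (col x l))).snd = _
  simp

/-- The feedback connection of `swapUnitary Φ Ψ V` with the load `T`: with
`(h, e) = Φ (x, l)` and `T (w, l) = (w', l')`, it maps `(h, w, e)` to `(h', w', f)`, where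
`(h', f) = Ψ (V x, l')`. -/
def feedback (Φ : HSum D L ≃ₗᵢ[ℂ] HSum M E) (Ψ : HSum R L' ≃ₗᵢ[ℂ] HSum M F) (V : D ≃ₗᵢ[ℂ] R)
    (T : HSum W L ≃ₗᵢ[ℂ] HSum W L') : HSum (HSum M W) E ≃ₗᵢ[ℂ] HSum (HSum M W) F where
  toFun z :=
    let p := Φ.symm (col z.fst.fst z.snd)
    let q := T (col z.fst.snd p.snd)
    let r := Ψ (col (V p.fst) q.snd)
    col (col r.fst q.fst) r.snd
  invFun z :=
    let p := Ψ.symm (col z.fst.fst z.snd)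
    let q := T.symm (col z.fst.snd p.snd)
    let r := Φ (col (V.symm p.fst) q.snd)
    col (col r.fst q.fst) r.snd
  map_add' z z' := by
    simp only [WithLp.add_fst, WithLp.add_snd, map_add, ← col_add_col]
  map_smul' c z := by
    simp only [WithLp.smul_fst, WithLp.smul_snd, ← smul_col, map_smul, RingHom.id_apply]
  left_inv z := by simp [col_eta]
  right_inv z := by simp [col_eta]
  norm_map' z := by
    refine (sq_eq_sq₀ (norm_nonneg _) (norm_nonneg _)).1 ?_
    set p := Φ.symm (col z.fst.fst z.snd) with hp
    set q := T (col z.fst.snd p.snd) with hq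
    set r := Ψ (col (V p.fst) q.snd) with hr
    have h1 : ‖p.fst‖ ^ 2 + ‖p.snd‖ ^ 2 = ‖z.fst.fst‖ ^ 2 + ‖z.snd‖ ^ 2 := by
      rw [← norm_col_sq, ← norm_col_sq, col_eta, hp, LinearIsometryEquiv.norm_map]
    have h2 : ‖q.fst‖ ^ 2 + ‖q.snd‖ ^ 2 = ‖z.fst.snd‖ ^ 2 + ‖p.snd‖ ^ 2 := by
      rw [← norm_col_sq, ← norm_col_sq, col_eta, hq, LinearIsometryEquiv.norm_map]
    have h3 : ‖r.fst‖ ^ 2 + ‖r.snd‖ ^ 2 = ‖p.fst‖ ^ 2 + ‖q.snd‖ ^ 2 := by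
      rw [← norm_col_sq, col_eta, hr, LinearIsometryEquiv.norm_map, norm_col_sq,
        LinearIsometryEquiv.norm_map]
    have h4 : ‖z‖ ^ 2 = ‖z.fst.fst‖ ^ 2 + ‖z.fst.snd‖ ^ 2 + ‖z.snd‖ ^ 2 := by
      rw [← norm_col_sq, ← norm_col_sq]
      rfl
    change ‖col (col r.fst q.fst) r.snd‖ ^ 2 = ‖z‖ ^ 2
    rw [h4, norm_col_sq, norm_col_sq]
    linarith

theorem feedback_col (Φ : HSum D L ≃ₗᵢ[ℂ] HSum M E) (Ψ : HSum R L' ≃ₗᵢ[ℂ] HSum M F)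
    (V : D ≃ₗᵢ[ℂ] R) (T : HSum W L ≃ₗᵢ[ℂ] HSum W L') (x : D) (l : L) (w : W) :
    feedback Φ Ψ V T (col (col (Φ (col x l)).fst w) (Φ (col x l)).snd) =
      col (col (Ψ (col (V x) (T (col w l)).snd)).fst (T (col w l)).fst)
        (Ψ (col (V x) (T (col w l)).snd)).snd := by
  change (let p := Φ.symm (Φ (col x l))
    let q := T (col w p.snd)
    let r := Ψ (col (V p.fst) q.snd)
    col (col r.fst q.fst) r.snd) = _
  simp

/-- Vectors of `(M ⊕ W) ⊕ E` are parametrized by `D`, `L` and `W`. -/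
theorem exists_eq_col_col {W : Type*} (Φ : HSum D L ≃ₗᵢ[ℂ] HSum M E) (z : HSum (HSum M W) E) :
    ∃ x l w, z = col (col (Φ (col x l)).fst w) (Φ (col x l)).snd := by
  obtain ⟨⟨x, l⟩, hp⟩ := Φ.surjective (col z.fst.fst z.snd)
  exact ⟨x, l, z.fst.snd, by rw [hp]; rfl⟩

/-- The feedback connection is described by solving for the internal signals `l` and `l'`. -/
theorem feedback_eq_iff (Φ : HSum D L ≃ₗᵢ[ℂ] HSum M E) (Ψ : HSum R L' ≃ₗᵢ[ℂ] HSum M F)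
    (V : D ≃ₗᵢ[ℂ] R) (T : HSum W L ≃ₗᵢ[ℂ] HSum W L') (h : M) (w : W) (e : E) (h' : M) (w' : W)
    (f : F) :
    feedback Φ Ψ V T (col (col h w) e) = col (col h' w') f ↔
      ∃! l : L × L', swapUnitary Φ Ψ V (col (col h e) l.2) = col (col h' f) l.1 ∧
        T (col w l.1) = col w' l.2 := by
  obtain ⟨⟨x, l⟩, hp⟩ := Φ.surjective (col h e)
  have hz : (col (col h w) e : HSum (HSum M W) E) =
      col (col (Φ (col x l)).fst w) (Φ (col x l)).snd := by rw [hp]; rfl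
  simp only [hz, feedback_col, ← hp, swapUnitary_col, col_inj]
  constructor
  · rintro ⟨⟨h1, h2⟩, h3⟩
    refine ⟨(l, (T (col w l)).snd), ⟨⟨?_, rfl⟩, ?_⟩, ?_⟩
    · rw [← h1, ← h3]; rfl
    · rw [← h2]; rfl
    · rintro ⟨m, m'⟩ ⟨⟨_, rfl⟩, h5⟩
      simp only at h5 ⊢
      rw [h5]; rfl
  · rintro ⟨⟨m, m'⟩, ⟨⟨h4, h6⟩, h5⟩, -⟩
    simp only at h4 h5 h6
    subst h6
    rw [h5, WithLp.toLp_snd, h4]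
    exact ⟨⟨rfl, rfl⟩, rfl⟩

theorem map_col (T : HSum X Y →L[ℂ] Z) (x : X) (y : Y) :
    T (col x y) = T (col x 0) + T (col 0 y) := by
  rw [← T.map_add, col_add_col, add_zero, zero_add]

theorem map_col_add (T : HSum X Y →L[ℂ] Z) (y y' : Y) :
    T (col 0 (y + y')) = T (col 0 y) + T (col 0 y') := by
  rw [← T.map_add, col_add_col, add_zero]

theorem explicitParam_col (U₀ : HSum (HSum M E) L' →L[ℂ] HSum (HSum M F) L)
    (T : HSum W L →L[ℂ] HSum W L') (h : M) (w : W) (e : E) {p : HSum (HSum M F) L}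
    (hp : U₀ (col (col h e) 0) = p) {q : HSum W L'} (hq : T (col w p.snd) = q) :
    explicitParam U₀ T (col (col h w) e) =
      col (col (p.fst.fst + (U₀ (col 0 q.snd)).fst.fst) q.fst)
        (p.fst.snd + (U₀ (col 0 q.snd)).fst.snd) := by
  subst hp
  set p₁ := U₀ (col (col h 0) 0) with hp₁
  set p₂ := U₀ (col (col 0 e) 0) with hp₂
  have h1 : U₀ (col (col h e) 0) = p₁ + p₂ := by
    have := map_col (U₀ ∘L inl (HSum M E) L') h e
    exact this
  rw [h1] at hq ⊢
  set q₀ := T (col w 0) with hq₀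
  set q₁ := T (col 0 p₁.snd) with hq₁
  set q₂ := T (col 0 p₂.snd) with hq₂
  have h2 : q = q₀ + (q₁ + q₂) := by
    rw [← hq, map_col, WithLp.add_snd, map_col_add]
  have h3 : U₀ (col 0 q.snd) =
      U₀ (col 0 q₀.snd) + (U₀ (col 0 q₁.snd) + U₀ (col 0 q₂.snd)) := by
    rw [h2, WithLp.add_snd, WithLp.add_snd, map_col_add, map_col_add]
  rw [h3, h2]
  simp only [explicitParam, block33, block22_col, row_col, colOp_apply, _root_.add_apply,
    ContinuousLinearMap.comp_apply, blk11_apply, blk12_apply, blk21_apply, blk22_apply, blk13,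
    blk23, blk31, blk32]
  change col (col (p₁.fst.fst + (U₀ (col 0 q₁.snd)).fst.fst + (U₀ (col 0 q₀.snd)).fst.fst)
    (q₁.fst + q₀.fst) + col (p₂.fst.fst + (U₀ (col 0 q₂.snd)).fst.fst) q₂.fst)
    (p₁.fst.snd + (U₀ (col 0 q₁.snd)).fst.snd + (U₀ (col 0 q₀.snd)).fst.snd +
      (p₂.fst.snd + (U₀ (col 0 q₂.snd)).fst.snd)) = _
  simp only [WithLp.add_fst, WithLp.add_snd, col_add_col, col_inj]
  refine ⟨⟨?_, ?_⟩, ?_⟩ <;> abel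

/-- The operator form of the feedback connection, in terms of the blocks of `swapUnitary Φ Ψ V`. -/
theorem explicitParam_eq_feedback (Φ : HSum D L ≃ₗᵢ[ℂ] HSum M E) (Ψ : HSum R L' ≃ₗᵢ[ℂ] HSum M F)
    (V : D ≃ₗᵢ[ℂ] R) (T : HSum W L ≃ₗᵢ[ℂ] HSum W L')
    (U₀ : HSum (HSum M E) L' →L[ℂ] HSum (HSum M F) L) (hU₀ : ∀ z, U₀ z = swapUnitary Φ Ψ V z)
    (T' : HSum W L →L[ℂ] HSum W L') (hT' : ∀ z, T' z = T z) (z : HSum (HSum M W) E) :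
    explicitParam U₀ T' z = feedback Φ Ψ V T z := by
  obtain ⟨x, l, w, rfl⟩ := exists_eq_col_col Φ z
  have h1 : U₀ (col (Φ (col x l)) 0) = col (Ψ (col (V x) 0)) l := by
    rw [hU₀, swapUnitary_col]
  have h2 : ∀ l', U₀ (col 0 l') = col (Ψ (col 0 l')) 0 := fun l' => by
    have := swapUnitary_col Φ Ψ V 0 0 l'
    rwa [map_zero, ← hU₀, show (col (0 : D) (0 : L)) = 0 from rfl, map_zero] at this
  rw [explicitParam_col U₀ T' (Φ (col x l)).fst w (Φ (col x l)).snd h1 (hT' _), feedback_col, h2]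
  have h3 : Ψ (col (V x) (T (col w l)).snd) = Ψ (col (V x) 0) + Ψ (col 0 (T (col w l)).snd) := by
    rw [← map_add, col_add_col, add_zero, zero_add]
  rw [h3]
  rfl

/-- The lower right block of the operator matrix in `redhefferParam` vanishes, so the inverse in the
Redheffer transform is that of the identity. -/
theorem redhefferParam_eq_explicitParam (U₀ : HSum (HSum M E) L' →L[ℂ] HSum (HSum M F) L)
    (T : HSum W L →L[ℂ] HSum W L') : redhefferParam U₀ T = explicitParam U₀ T := by
  ext1 z
  obtain ⟨⟨h, w⟩, e⟩ := z
  change redhefferParam U₀ T (col (col h w) e) = explicitParam U₀ T (col (col h w) e)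
  simp only [redhefferParam, explicitParam, redheffer, ContinuousLinearMap.comp_zero, sub_zero,
    Ring.inverse_one, block33, block22_col, row_col, colOp_apply, _root_.add_apply,
    ContinuousLinearMap.comp_apply, _root_.zero_apply,
    one_apply_eq_self, add_zero, zero_add, col_add_col, blk11_apply, blk12_apply,
    blk21_apply, blk22_apply]
  have hT : T (col w (blk31 U₀ h + blk32 U₀ e)) =
      T (col w 0) + (T (col 0 (blk31 U₀ h)) + T (col 0 (blk32 U₀ e))) := by
    rw [map_col, map_col_add]
  have hB : ∀ z, (block22 0 (blk13 U₀) 1 0 : HSum W L' →L[ℂ] HSum M W) z =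
      col (blk13 U₀ z.snd) z.fst := fun z => by
    rw [← col_eta z, block22_col]
    simp
  have hR : ∀ z, (row 0 (blk23 U₀) : HSum W L' →L[ℂ] F) z = blk23 U₀ z.snd := fun z => by
    rw [← col_eta z, row_col]
    simp
  rw [hT, hB, hR, col_add_col]
  simp only [WithLp.add_fst, WithLp.add_snd, map_add, col_inj]
  refine ⟨⟨?_, ?_⟩, ?_⟩ <;> abel

/-! ### Unitary extensions and loads -/

theorem inner_col_col (Φ : HSum D L ≃ₗᵢ[ℂ] HSum M E) (x x' : D) (l l' : L) (w w' : W) :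
    ⟪(col (col (Φ (col x l)).fst w) (Φ (col x l)).snd : HSum (HSum M W) E),
      col (col (Φ (col x' l')).fst w') (Φ (col x' l')).snd⟫ =
        ⟪x, x'⟫ + ⟪l, l'⟫ + ⟪w, w'⟫ := by
  have h : ⟪Φ (col x l), Φ (col x' l')⟫ = ⟪x, x'⟫ + ⟪l, l'⟫ := by
    rw [LinearIsometryEquiv.inner_map_map, inner_col]
  rw [← h, inner_col, inner_col, inner_eq_fst_add_snd]
  abel

/-- The isometric inclusion of `W ⊕ L` into `(M ⊕ W) ⊕ E`, onto the orthogonal complement of the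
copy of `D`. -/
def loadInclusion (W : Type*) [NormedAddCommGroup W] [InnerProductSpace ℂ W]
    (Φ : HSum D L ≃ₗᵢ[ℂ] HSum M E) : HSum W L →ₗᵢ[ℂ] HSum (HSum M W) E :=
  LinearMap.isometryOfInner
    (colOp (colOp (prl M E ∘L (Φ.toContinuousLinearEquiv : HSum D L →L[ℂ] HSum M E) ∘L inr D L ∘L
      prr W L) (prl W L))
      (prr M E ∘L (Φ.toContinuousLinearEquiv : HSum D L →L[ℂ] HSum M E) ∘L inr D L ∘L
        prr W L)).toLinearMap
    fun z z' => by
      simp only [ContinuousLinearMap.coe_coe, colOp_apply]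
      refine (inner_col_col Φ 0 0 z.snd z'.snd z.fst z'.fst).trans ?_
      rw [inner_eq_fst_add_snd, inner_zero_left, zero_add, add_comm]

theorem loadInclusion_col (Φ : HSum D L ≃ₗᵢ[ℂ] HSum M E) (w : W) (l : L) :
    loadInclusion W Φ (col w l) = col (col (Φ (col 0 l)).fst w) (Φ (col 0 l)).snd := by
  change (colOp _ _) _ = _
  rw [colOp_apply, colOp_apply]
  rfl

theorem col_col_eq_add (Φ : HSum D L ≃ₗᵢ[ℂ] HSum M E) (x : D) (l : L) (w : W) :
    (col (col (Φ (col x l)).fst w) (Φ (col x l)).snd : HSum (HSum M W) E) =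
      col (col (Φ (col x 0)).fst 0) (Φ (col x 0)).snd + loadInclusion W Φ (col w l) := by
  have h : Φ (col x l) = Φ (col x 0) + Φ (col 0 l) := by
    rw [← map_add, col_add_col, add_zero, zero_add]
  rw [loadInclusion_col, col_add_col, col_add_col, zero_add, ← WithLp.add_fst,
    ← WithLp.add_snd, ← h]

theorem feedback_loadInclusion (Φ : HSum D L ≃ₗᵢ[ℂ] HSum M E) (Ψ : HSum R L' ≃ₗᵢ[ℂ] HSum M F)
    (V : D ≃ₗᵢ[ℂ] R) (T : HSum W L ≃ₗᵢ[ℂ] HSum W L') (z : HSum W L) :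
    feedback Φ Ψ V T (loadInclusion W Φ z) = loadInclusion W Ψ (T z) := by
  rw [← col_eta z, loadInclusion_col, feedback_col, map_zero, ← loadInclusion_col]
  rfl

/-- A unitary operator that acts as `V` on the copy of `D` is a feedback connection: it maps the
orthogonal complement of the copy of `D` onto that of the copy of `R`. -/
theorem exists_eq_feedback (Φ : HSum D L ≃ₗᵢ[ℂ] HSum M E) (Ψ : HSum R L' ≃ₗᵢ[ℂ] HSum M F)
    (V : D ≃ₗᵢ[ℂ] R) (U : HSum (HSum M W) E ≃ₗᵢ[ℂ] HSum (HSum M W) F)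
    (hU : ∀ x, U (col (col (Φ (col x 0)).fst 0) (Φ (col x 0)).snd) =
      col (col (Ψ (col (V x) 0)).fst 0) (Ψ (col (V x) 0)).snd) :
    ∃ T : HSum W L ≃ₗᵢ[ℂ] HSum W L', U = feedback Φ Ψ V T := by
  obtain ⟨T, hT⟩ := exists_restrict (loadInclusion W Φ) (loadInclusion W Ψ) U
    (fun z => by
      obtain ⟨r, l', w', h⟩ := exists_eq_col_col Ψ (U (loadInclusion W Φ z))
      have h1 : ⟪U (col (col (Φ (col (V.symm r) 0)).fst 0) (Φ (col (V.symm r) 0)).snd),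
          U (loadInclusion W Φ z)⟫ = 0 := by
        rw [LinearIsometryEquiv.inner_map_map, ← col_eta z, loadInclusion_col, inner_col_col]
        simp
      rw [hU, h, inner_col_col, LinearIsometryEquiv.apply_symm_apply] at h1
      have h2 : r = 0 := by simpa using h1
      exact ⟨col w' l', by rw [h, h2, loadInclusion_col]⟩)
    (fun z => by
      obtain ⟨x, l, w, h⟩ := exists_eq_col_col Φ (U.symm (loadInclusion W Ψ z))
      have h1 : ⟪U (col (col (Φ (col x 0)).fst 0) (Φ (col x 0)).snd),
          U (U.symm (loadInclusion W Ψ z))⟫ = 0 := by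
        rw [hU, LinearIsometryEquiv.apply_symm_apply, ← col_eta z, loadInclusion_col,
          inner_col_col]
        simp
      rw [LinearIsometryEquiv.inner_map_map, h, inner_col_col] at h1
      have h2 : x = 0 := by simpa using h1
      refine ⟨col w l, ?_⟩
      rw [loadInclusion_col, ← h2, ← h, LinearIsometryEquiv.apply_symm_apply])
  refine ⟨T, LinearIsometryEquiv.ext fun z => ?_⟩
  obtain ⟨x, l, w, rfl⟩ := exists_eq_col_col Φ z
  rw [feedback_col, col_col_eq_add, map_add, hU, hT, ← col_eta (T _), ← col_col_eq_add]
  rfl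

theorem GRUnitary.ext' {d : ℕ} [CompleteSpace X] {G G' : GRUnitary d X E F} (hP : G.P = G'.P)
    (hU : G.U = G'.U) : G = G' := by
  cases G; cases G'
  simp only at hP hU
  subst hP hU
  rfl

variable {d : ℕ} [CompleteSpace M] [CompleteSpace W]

/-- `G` is the feedback connection of `swapUnitary Φ Ψ V` with the load `Gt`, where the projections
of `G` on `M` are `Q₁, …, Q_d`. -/
def IsLoaded (Φ : HSum D L ≃ₗᵢ[ℂ] HSum M E) (Ψ : HSum R L' ≃ₗᵢ[ℂ] HSum M F)
    (V : D ≃ₗᵢ[ℂ] R) (Q : Fin d → M →L[ℂ] M) (Gt : GRUnitary d W L L')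
    (G : GRUnitary d (HSum M W) E F) : Prop :=
  (∀ k h w, G.P k (col h w) = col (Q k h) (Gt.P k w)) ∧ G.U = feedback Φ Ψ V Gt.U

variable {Φ : HSum D L ≃ₗᵢ[ℂ] HSum M E} {Ψ : HSum R L' ≃ₗᵢ[ℂ] HSum M F} {V : D ≃ₗᵢ[ℂ] R}
  {Q : Fin d → M →L[ℂ] M}

/-- Loads produce feedback connections; the projections of `G` are `Q k ⊕ Gt.P k`. -/
theorem existsUnique_isLoaded (hQ : ∀ k, IsStarProjection (Q k))
    (hQo : ∀ j k, j ≠ k → Q j ∘L Q k = 0) (hQs : ∑ k, Q k = 1) (Gt : GRUnitary d W L L') :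
    ∃! G : GRUnitary d (HSum M W) E F, IsLoaded Φ Ψ V Q Gt G := by
  have hP : ∀ k h w, block22 (Q k) 0 0 (Gt.P k) (col h w) = col (Q k h) (Gt.P k w) := by
    intro k h w
    simp [block22_col]
  refine ⟨⟨fun k => block22 (Q k) 0 0 (Gt.P k), fun k => ⟨?_, ?_⟩, fun j k hjk => ?_, ?_,
    feedback Φ Ψ V Gt.U⟩, ⟨hP, rfl⟩, ?_⟩
  · ext1 z
    obtain ⟨h, w⟩ := z
    change block22 (Q k) 0 0 (Gt.P k) (block22 (Q k) 0 0 (Gt.P k) (col h w)) =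
      block22 (Q k) 0 0 (Gt.P k) (col h w)
    rw [hP, hP, col_inj]
    constructor
    · exact DFunLike.congr_fun (hQ k).isIdempotentElem h
    · exact DFunLike.congr_fun (Gt.isStarProjection k).isIdempotentElem w
  · rw [ContinuousLinearMap.isSelfAdjoint_iff_isSymmetric]
    rintro ⟨h, w⟩ ⟨h', w'⟩
    change ⟪block22 (Q k) 0 0 (Gt.P k) (col h w), col h' w'⟫ =
      ⟪col h w, block22 (Q k) 0 0 (Gt.P k) (col h' w')⟫
    rw [hP, hP, inner_col, inner_col]
    congr 1
    · exact (ContinuousLinearMap.isSelfAdjoint_iff_isSymmetric.1 (hQ k).isSelfAdjoint) h h'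
    · exact (ContinuousLinearMap.isSelfAdjoint_iff_isSymmetric.1
        (Gt.isStarProjection k).isSelfAdjoint) w w'
  · ext1 z
    obtain ⟨h, w⟩ := z
    change block22 (Q j) 0 0 (Gt.P j) (block22 (Q k) 0 0 (Gt.P k) (col h w)) = col 0 0
    rw [hP, hP, col_inj]
    constructor
    · exact DFunLike.congr_fun (hQo j k hjk) h
    · exact DFunLike.congr_fun (Gt.orthogonal j k hjk) w
  · ext1 z
    obtain ⟨h, w⟩ := z
    change (∑ k, block22 (Q k) 0 0 (Gt.P k)) (col h w) = col h w
    have h1 := DFunLike.congr_fun hQs h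
    have h2 := DFunLike.congr_fun Gt.sum_eq_one w
    rw [_root_.sum_apply] at h1 h2 ⊢
    simp only [hP]
    rw [sum_col, h1, h2]
    rfl
  · rintro G ⟨h1, h2⟩
    refine GRUnitary.ext' (funext fun k => ?_) h2
    ext1 z
    exact (h1 k z.fst z.snd).trans (hP k z.fst z.snd).symm

/-- A unitary extension of `V` is the feedback connection with a unique load. The load inherits the
projections of `G` on `W`. -/
theorem existsUnique_load (Pt : Fin d → W →L[ℂ] W) (G : GRUnitary d (HSum M W) E F)
    (hG : ∀ k h w, G.P k (col h w) = col (Q k h) (Pt k w))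
    (hU : ∀ x, G.U (col (col (Φ (col x 0)).fst 0) (Φ (col x 0)).snd) =
      col (col (Ψ (col (V x) 0)).fst 0) (Ψ (col (V x) 0)).snd) :
    ∃! Gt : GRUnitary d W L L', IsLoaded Φ Ψ V Q Gt G := by
  obtain ⟨T, hT⟩ := exists_eq_feedback Φ Ψ V G.U hU
  have h0 : ∀ k w, G.P k (col 0 w) = col 0 (Pt k w) := fun k w => by rw [hG, map_zero]
  refine ⟨⟨Pt, fun k => ⟨?_, ?_⟩, fun j k hjk => ?_, ?_, T⟩, ⟨hG, hT⟩, ?_⟩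
  · ext1 w
    have := DFunLike.congr_fun (G.isStarProjection k).isIdempotentElem (col 0 w)
    rw [ContinuousLinearMap.mul_def, ContinuousLinearMap.comp_apply, h0, h0] at this
    exact (col_inj.1 this).2
  · rw [ContinuousLinearMap.isSelfAdjoint_iff_isSymmetric]
    intro w w'
    have := (ContinuousLinearMap.isSelfAdjoint_iff_isSymmetric.1
      (G.isStarProjection k).isSelfAdjoint) (col 0 w) (col 0 w')
    rw [ContinuousLinearMap.coe_coe, h0, h0, inner_col, inner_col] at this
    simpa using this
  · ext1 w
    have := DFunLike.congr_fun (G.orthogonal j k hjk) (col 0 w)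
    rw [ContinuousLinearMap.comp_apply, h0, h0] at this
    exact (col_inj.1 (this.trans (show _ = col 0 0 from rfl))).2
  · ext1 w
    have := congrArg (prr M W) (DFunLike.congr_fun G.sum_eq_one (col 0 w))
    rw [_root_.sum_apply] at this ⊢
    simp only [h0, map_sum] at this
    exact this
  · rintro G' ⟨h1, h2⟩
    refine GRUnitary.ext' (funext fun k => ?_) (LinearIsometryEquiv.ext fun z => ?_)
    · ext1 w
      have := (h1 k 0 w).symm.trans (hG k 0 w)
      exact (col_inj.1 this).2
    · refine (loadInclusion W Ψ).injective ?_
      rw [← feedback_loadInclusion Φ Ψ V, ← feedback_loadInclusion Φ Ψ V, ← h2, ← hT]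

end Feedback

/-! ### Complementary subspaces and coordinate projections -/

section Inclusions

variable {W W' M E D L : Type*}
  [NormedAddCommGroup W] [InnerProductSpace ℂ W] [NormedAddCommGroup W'] [InnerProductSpace ℂ W']
  [NormedAddCommGroup M] [InnerProductSpace ℂ M] [NormedAddCommGroup E] [InnerProductSpace ℂ E]
  [NormedAddCommGroup D] [InnerProductSpace ℂ D] [NormedAddCommGroup L] [InnerProductSpace ℂ L]

theorem loadInclusion_col_zero (Φ : HSum D L ≃ₗᵢ[ℂ] HSum M E) (w : W) :
    loadInclusion W Φ (col w 0) = col (col 0 w) 0 := by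
  rw [loadInclusion_col, show (col (0 : D) (0 : L)) = 0 from rfl, map_zero]
  rfl

/-- The inclusion of the second summand as an isometry. -/
def inrIsometry (M W : Type*) [NormedAddCommGroup M] [InnerProductSpace ℂ M]
    [NormedAddCommGroup W] [InnerProductSpace ℂ W] : W →ₗᵢ[ℂ] HSum M W :=
  (inr M W).toLinearMap.isometryOfInner fun w w' => by
    refine (inner_col (0 : M) 0 w w').trans ?_
    rw [inner_zero_left, zero_add]

/-- The inclusion of the first summand as an isometry. -/
def inlIsometry (M W : Type*) [NormedAddCommGroup M] [InnerProductSpace ℂ M]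
    [NormedAddCommGroup W] [InnerProductSpace ℂ W] : M →ₗᵢ[ℂ] HSum M W :=
  (inl M W).toLinearMap.isometryOfInner fun h h' => by
    refine (inner_col h h' (0 : W) 0).trans ?_
    rw [inner_zero_left, add_zero]

theorem inrIsometry_apply (w : W) : inrIsometry M W w = col 0 w := rfl

theorem exists_id_sum (ω : W ≃ₗᵢ[ℂ] W') :
    ∃ Ω : HSum M W ≃ₗᵢ[ℂ] HSum M W', ∀ h w, Ω (col h w) = col h (ω w) :=
  ⟨LinearIsometryEquiv.withLpProdCongr 2 (.refl ℂ M) ω, fun _ _ => rfl⟩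

/-- The identification `D ⊕ L = M ⊕ E` when `L ⊕ 0` is the orthogonal complement of `D`. -/
def complementUnitary (D : Submodule ℂ (HSum M E)) (L : Submodule ℂ M) [CompleteSpace D]
    (h : ∀ f e, col f e ∈ Dᗮ ↔ f ∈ L ∧ e = 0) : HSum D L ≃ₗᵢ[ℂ] HSum M E :=
  orthogonalSum D.subtypeₗᵢ ((inlIsometry M E).comp L.subtypeₗᵢ)
    (fun x l => (h l 0).2 ⟨l.2, rfl⟩ x x.2)
    (fun z => by
      obtain ⟨x, hx, y, hy, rfl⟩ := D.exists_add_mem_mem_orthogonal z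
      obtain ⟨hl, he⟩ := (h y.fst y.snd).1 hy
      exact ⟨⟨x, hx⟩, ⟨y.fst, hl⟩, congrArg (x + ·) (eq_col_zero he)⟩)

theorem complementUnitary_col (D : Submodule ℂ (HSum M E)) (L : Submodule ℂ M) [CompleteSpace D]
    (h : ∀ f e, col f e ∈ Dᗮ ↔ f ∈ L ∧ e = 0) (x : D) (l : L) :
    complementUnitary D L h (col x l) = (x : HSum M E) + col (l : M) 0 := rfl

theorem complementUnitary_col_zero (D : Submodule ℂ (HSum M E)) (L : Submodule ℂ M)
    [CompleteSpace D] (h : ∀ f e, col f e ∈ Dᗮ ↔ f ∈ L ∧ e = 0) (x : D) :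
    complementUnitary D L h (col x 0) = (x : HSum M E) := by
  rw [complementUnitary_col]
  exact add_zero _

theorem complementUnitary_zero_col (D : Submodule ℂ (HSum M E)) (L : Submodule ℂ M)
    [CompleteSpace D] (h : ∀ f e, col f e ∈ Dᗮ ↔ f ∈ L ∧ e = 0) (l : L) :
    complementUnitary D L h (col 0 l) = col (l : M) 0 := by
  rw [complementUnitary_col]
  exact zero_add _

/-- The three defining properties of `swapUnitary` on `D`, `L` and `L'`. -/
theorem eq_swapUnitary_iff {F : Type*} [NormedAddCommGroup F] [InnerProductSpace ℂ F]
    {D : Submodule ℂ (HSum M E)} {L : Submodule ℂ M} [CompleteSpace D]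
    (h : ∀ f e, col f e ∈ Dᗮ ↔ f ∈ L ∧ e = 0)
    {R : Submodule ℂ (HSum M F)} {L' : Submodule ℂ M} [CompleteSpace R]
    (h' : ∀ f e, col f e ∈ Rᗮ ↔ f ∈ L' ∧ e = 0) (V : D ≃ₗᵢ[ℂ] R)
    (U : HSum (HSum M E) L' ≃ₗᵢ[ℂ] HSum (HSum M F) L) :
    ((∀ x : D, U (col (x : HSum M E) 0) = col (V x : HSum M F) 0) ∧
      (∀ l : L, U (col (col (l : M) 0) 0) = col 0 l) ∧
      (∀ l' : L', U (col 0 l') = col (col (l' : M) 0) 0)) ↔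
    U = swapUnitary (complementUnitary D L h) (complementUnitary R L' h') V := by
  constructor
  · rintro ⟨h1, h2, h3⟩
    refine LinearIsometryEquiv.ext fun z => ?_
    obtain ⟨y, l'⟩ := z
    obtain ⟨⟨x, l⟩, rfl⟩ := (complementUnitary D L h).surjective y
    change U (col (complementUnitary D L h (col x l)) l') =
      swapUnitary _ _ _ (col (complementUnitary D L h (col x l)) l')
    rw [swapUnitary_col, complementUnitary_col, complementUnitary_col]
    have e1 : (col ((x : HSum M E) + col (l : M) 0) l' : HSum (HSum M E) L') =
        (col (x : HSum M E) 0 + col (col (l : M) 0) 0) + col 0 l' := by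
      rw [col_add_col (x : HSum M E), add_zero, col_add_col _ (0 : HSum M E), add_zero, zero_add]
    rw [e1, map_add, map_add, h1, h2, h3, col_add_col (V x : HSum M F), add_zero,
      col_add_col _ (col (l' : M) 0), zero_add, add_zero]
  · rintro rfl
    refine ⟨fun x => ?_, fun l => ?_, fun l' => ?_⟩
    · rw [← complementUnitary_col_zero D L h, swapUnitary_col, complementUnitary_col_zero]
    · rw [← complementUnitary_zero_col D L h, swapUnitary_col, map_zero,
        show (col (0 : R) (0 : L')) = 0 from rfl, map_zero]
    · have := swapUnitary_col (complementUnitary D L h) (complementUnitary R L' h') V 0 0 l'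
      rwa [map_zero, complementUnitary_zero_col R, show (col (0 : D) (0 : L)) = 0 from rfl,
        map_zero] at this

end Inclusions

section CoordinateProjections

variable {d : ℕ} (H : Fin d → Type*) [∀ k, NormedAddCommGroup (H k)]
  [∀ k, InnerProductSpace ℂ (H k)]

/-- The orthogonal projection of a Hilbert space direct sum onto its `k`-th summand. -/
def coordProj (k : Fin d) : PiLp 2 H →L[ℂ] PiLp 2 H :=
  ((PiLp.continuousLinearEquiv 2 ℂ H).symm : (∀ k, H k) →L[ℂ] PiLp 2 H) ∘L
    ContinuousLinearMap.single ℂ H k ∘L PiLp.proj 2 H k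

theorem coordProj_apply (k : Fin d) (h : PiLp 2 H) : coordProj H k h = PiLp.single 2 k (h k) := rfl

theorem coordProj_comp_of_ne (j k : Fin d) (hjk : j ≠ k) :
    coordProj H j ∘L coordProj H k = 0 := by
  ext1 h
  simp [coordProj_apply, hjk]

theorem sum_coordProj : ∑ k, coordProj H k = 1 := by
  ext1 h
  rw [_root_.sum_apply]
  refine WithLp.ofLp_injective 2 ?_
  simp [coordProj_apply, WithLp.ofLp_sum, Finset.univ_sum_single]

theorem isStarProjection_coordProj [∀ k, CompleteSpace (H k)] (k : Fin d) :
    IsStarProjection (coordProj H k) := by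
  refine ⟨?_, ?_⟩
  · ext1 h
    simp [coordProj_apply]
  · rw [ContinuousLinearMap.isSelfAdjoint_iff_isSymmetric]
    intro h h'
    change ⟪coordProj H k h, h'⟫ = ⟪h, coordProj H k h'⟫
    rw [PiLp.inner_apply, PiLp.inner_apply, Finset.sum_eq_single k, Finset.sum_eq_single k]
    all_goals simp +contextual [coordProj_apply]

end CoordinateProjections

/-! ### Close connectedness and unitary equivalence of loads -/

section LoadProperties

variable {d : ℕ} {X W W' M E F D R L L' : Type*}
  [NormedAddCommGroup X] [InnerProductSpace ℂ X] [CompleteSpace X]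
  [NormedAddCommGroup W] [InnerProductSpace ℂ W] [CompleteSpace W]
  [NormedAddCommGroup W'] [InnerProductSpace ℂ W'] [CompleteSpace W']
  [NormedAddCommGroup M] [InnerProductSpace ℂ M] [CompleteSpace M]
  [NormedAddCommGroup E] [InnerProductSpace ℂ E] [NormedAddCommGroup F] [InnerProductSpace ℂ F]
  [NormedAddCommGroup D] [InnerProductSpace ℂ D] [NormedAddCommGroup R] [InnerProductSpace ℂ R]
  [NormedAddCommGroup L] [InnerProductSpace ℂ L] [NormedAddCommGroup L'] [InnerProductSpace ℂ L']

/-- A colligation is closely connected exactly when its operator does not act as a unitary operator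
on a nonzero closed subspace of the state space that is invariant for the projections: such
subspaces are the orthogonal complements of those in the definition of `CloselyConnected`. -/
theorem GRUnitary.closelyConnected_iff [CompleteSpace E] [CompleteSpace F]
    (G : GRUnitary d X E F) :
    G.CloselyConnected ↔ ∀ N : Submodule ℂ X, IsClosed (N : Set X) →
      (∀ x ∈ N, ∃ y ∈ N, G.U (col x 0) = col y 0) →
      (∀ y ∈ N, ∃ x ∈ N, G.U (col x 0) = col y 0) →
      (∀ k, ∀ x ∈ N, G.P k x ∈ N) → N = ⊥ := by
  have hA : ∀ x y, ⟪y, G.A x⟫ = ⟪col y 0, G.U (col x 0)⟫ := fun x y =>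
    (inner_col_zero_left y _).symm
  have hB : ∀ e y, ⟪y, G.B e⟫ = ⟪col y 0, G.U (col 0 e)⟫ := fun x y =>
    (inner_col_zero_left y _).symm
  constructor
  · intro h N _ hN hN' hP
    rw [← Submodule.orthogonal_eq_top_iff]
    refine h Nᗮ N.isClosed_orthogonal (fun e => ?_) (fun f => ?_) (fun z hz => ?_) (fun z hz => ?_)
      (fun k z hz => ?_) <;> rw [Submodule.mem_orthogonal]
    · intro y hy
      obtain ⟨x, hx, hxy⟩ := hN' y hy
      rw [hB, ← hxy, LinearIsometryEquiv.inner_map_map, inner_col]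
      simp
    · intro x hx
      obtain ⟨y, hy, hxy⟩ := hN x hx
      rw [ContinuousLinearMap.adjoint_inner_right]
      have : G.C x = 0 := congrArg (fun z => z.snd) hxy
      rw [this, inner_zero_left]
    · intro y hy
      obtain ⟨x, hx, hxy⟩ := hN' y hy
      rw [hA, ← hxy, LinearIsometryEquiv.inner_map_map, inner_col, inner_zero_left, add_zero]
      exact hz x hx
    · intro x hx
      obtain ⟨y, hy, hxy⟩ := hN x hx
      rw [ContinuousLinearMap.adjoint_inner_right]
      have : G.A x = y := congrArg (fun z => z.fst) hxy
      rw [this]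
      exact hz y hy
    · intro x hx
      have h1 := (ContinuousLinearMap.isSelfAdjoint_iff_isSymmetric.1
        (G.isStarProjection k).isSelfAdjoint) x z
      exact h1.symm.trans (hz _ (hP k x hx))
  · intro h K hKc hB' hC hA' hAs hP
    have : CompleteSpace K := hKc.completeSpace_coe
    rw [← Submodule.orthogonal_eq_bot_iff]
    have hU : ∀ x ∈ Kᗮ, G.C x = 0 := fun x hx => ext_inner_left ℂ fun f => by
      rw [← ContinuousLinearMap.adjoint_inner_left, hx _ (hC f), inner_zero_right]
    refine h Kᗮ K.isClosed_orthogonal (fun x hx => ⟨G.A x, fun m hm => ?_, ?_⟩) (fun y hy => ?_)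
      (fun k x hx m hm => ?_)
    · rw [← ContinuousLinearMap.adjoint_inner_left]
      exact hx _ (hAs m hm)
    · rw [← col_eta (G.U (col x 0)), col_inj]
      exact ⟨rfl, hU x hx⟩
    · have hw : G.U (G.U.symm (col y 0)) = col y 0 := G.U.apply_symm_apply _
      set w := G.U.symm (col y 0) with hwdef
      have h1 : w.fst ∈ Kᗮ := fun m hm => by
        rw [← inner_col_zero_left, ← LinearIsometryEquiv.inner_map_map G.U, hw,
          ← inner_conj_symm, ← hA,
          inner_conj_symm]
        exact hy _ (hA' m hm)
      have h3 : w.snd = 0 := ext_inner_left ℂ fun e => by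
        rw [← inner_zero_col_left, ← LinearIsometryEquiv.inner_map_map G.U, hw,
          ← inner_conj_symm, ← hB,
          inner_conj_symm, inner_zero_right]
        exact hy _ (hB' e)
      refine ⟨w.fst, h1, ?_⟩
      rw [← eq_col_zero h3, hw]
    · have h1 := (ContinuousLinearMap.isSelfAdjoint_iff_isSymmetric.1
        (G.isStarProjection k).isSelfAdjoint) m x
      exact h1.symm.trans (hx _ (hP k m hm))

variable {Φ : HSum D L ≃ₗᵢ[ℂ] HSum M E} {Ψ : HSum R L' ≃ₗᵢ[ℂ] HSum M F} {V : D ≃ₗᵢ[ℂ] R}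
  {Q : Fin d → M →L[ℂ] M}

theorem IsLoaded.apply_loadInclusion {Gt : GRUnitary d W L L'} {G : GRUnitary d (HSum M W) E F}
    (hG : IsLoaded Φ Ψ V Q Gt G) (z : HSum W L) :
    G.U (loadInclusion W Φ z) = loadInclusion W Ψ (Gt.U z) := by
  rw [hG.2, feedback_loadInclusion]

/-- On `0 ⊕ W` the operators of `G` and of the load agree as far as they stay in `0 ⊕ W`, so the
subspaces of `closelyConnected_iff` are the same for both. -/
theorem IsLoaded.closelyConnected_iff [CompleteSpace L] [CompleteSpace L']
    {Gt : GRUnitary d W L L'} {G : GRUnitary d (HSum M W) E F} (hG : IsLoaded Φ Ψ V Q Gt G) :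
    Gt.CloselyConnected ↔
      ¬ ∃ N : Submodule ℂ (HSum M W), N ≠ ⊥ ∧ IsClosed (N : Set (HSum M W)) ∧
        (∀ x ∈ N, x.fst = 0) ∧
        (fun x => G.U (col x 0)) '' (N : Set (HSum M W)) =
          (fun x => col x 0) '' (N : Set (HSum M W)) ∧
        ∀ k, ∀ x ∈ N, G.P k x ∈ N := by
  have key : ∀ w w', G.U (col (col 0 w) 0) = col (col 0 w') 0 ↔ Gt.U (col w 0) = col w' 0 := by
    intro w w'
    rw [← loadInclusion_col_zero Φ, ← loadInclusion_col_zero Ψ, hG.apply_loadInclusion,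
      (loadInclusion W Ψ).injective.eq_iff]
  have hP : ∀ k w, G.P k (col 0 w) = col 0 (Gt.P k w) := fun k w => by rw [hG.1, map_zero]
  rw [GRUnitary.closelyConnected_iff]
  constructor
  · rintro h ⟨N, hN0, hNc, hN1, hNU, hNP⟩
    have hmem : ∀ x ∈ N, x = col 0 x.snd := fun x hx => by
      rw [← hN1 x hx, col_eta]
    refine hN0 ?_
    have hcomap := h (N.comap (inr M W).toLinearMap) (hNc.preimage (inr M W).continuous)
      (fun w hw => ?_) (fun w' hw' => ?_) (fun k w hw => ?_)
    · rw [Submodule.eq_bot_iff] at hcomap ⊢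
      intro x hx
      have h1 : x.snd ∈ N.comap (inr M W).toLinearMap := by
        change col 0 x.snd ∈ N
        rwa [← hmem x hx]
      rw [hmem x hx, hcomap _ h1]
      rfl
    · have h1 : G.U (col (col 0 w) 0) ∈ (fun x => col x 0) '' (N : Set (HSum M W)) :=
        hNU ▸ ⟨col 0 w, hw, rfl⟩
      obtain ⟨y, hy, hyw⟩ := h1
      refine ⟨y.snd, ?_, ?_⟩
      · change col 0 y.snd ∈ N
        rwa [← hmem y hy]
      · rw [← key, ← hmem y hy]
        exact hyw.symm
    · have h1 : (col (col 0 w') 0 : HSum (HSum M W) F) ∈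
          (fun x => G.U (col x 0)) '' (N : Set (HSum M W)) :=
        hNU ▸ ⟨col 0 w', hw', rfl⟩
      obtain ⟨y, hy, hyw⟩ := h1
      refine ⟨y.snd, ?_, ?_⟩
      · change col 0 y.snd ∈ N
        rwa [← hmem y hy]
      · rw [← key, ← hmem y hy]
        exact hyw
    · change col 0 (Gt.P k w) ∈ N
      rw [← hP]
      exact hNP k _ hw
  · intro h N hNc hN hN' hNP
    by_contra hN0
    refine h ⟨N.map (inr M W).toLinearMap, ?_, ?_, ?_, ?_, ?_⟩
    · intro h0
      refine hN0 ((Submodule.eq_bot_iff _).2 fun w hw => ?_)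
      have h1 : (col 0 w : HSum M W) ∈ N.map (inr M W).toLinearMap := ⟨w, hw, rfl⟩
      rw [h0, Submodule.mem_bot] at h1
      exact congrArg (fun z => z.snd) h1
    · have h1 : ((N.map (inr M W).toLinearMap : Submodule ℂ (HSum M W)) : Set (HSum M W)) =
          {z | z.fst = 0} ∩ (prr M W) ⁻¹' N := by
        ext z
        constructor
        · rintro ⟨w, hw, rfl⟩
          exact ⟨rfl, hw⟩
        · rintro ⟨h1, h2⟩
          refine ⟨z.snd, h2, ?_⟩
          change col 0 z.snd = z
          rw [← (show z.fst = 0 from h1), col_eta]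
      rw [h1]
      exact (isClosed_eq (prl M W).continuous continuous_const).inter
        (hNc.preimage (prr M W).continuous)
    · rintro _ ⟨w, hw, rfl⟩
      rfl
    · ext z
      constructor
      · rintro ⟨_, ⟨w, hw, rfl⟩, rfl⟩
        obtain ⟨w', hw', hww'⟩ := hN w hw
        exact ⟨_, ⟨w', hw', rfl⟩, ((key w w').2 hww').symm⟩
      · rintro ⟨_, ⟨w, hw, rfl⟩, rfl⟩
        obtain ⟨w', hw', hww'⟩ := hN' w hw
        exact ⟨_, ⟨w', hw', rfl⟩, (key w' w).2 hww'⟩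
    · rintro k _ ⟨w, hw, rfl⟩
      exact ⟨_, hNP k w hw, (hP k w).symm⟩

/-- A unitary equivalence that is the identity on `M` preserves the complement `W` of `M`, and its
restriction is an equivalence of the loads. -/
theorem IsLoaded.unitarilyEquivalent_iff {Gt : GRUnitary d W L L'} {Gt' : GRUnitary d W' L L'}
    {G : GRUnitary d (HSum M W) E F} {G' : GRUnitary d (HSum M W') E F}
    (hG : IsLoaded Φ Ψ V Q Gt G) (hG' : IsLoaded Φ Ψ V Q Gt' G') :
    Gt.UnitarilyEquivalent Gt' ↔
      ∃ ω : HSum M W ≃ₗᵢ[ℂ] HSum M W', GRUnitary.EquivVia ω G G' ∧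
        ∀ h : M, ω (col h 0) = col h 0 := by
  constructor
  · rintro ⟨ω, hωP, hωU⟩
    obtain ⟨Ω, hΩ⟩ := exists_id_sum (M := M) ω
    refine ⟨Ω, ⟨fun k z => ?_, fun z e => ?_⟩, fun h => by rw [hΩ, map_zero]⟩
    · obtain ⟨h, w⟩ := z
      change Ω (G.P k (col h w)) = G'.P k (Ω (col h w))
      rw [hG.1, hΩ, hΩ, hG'.1, hωP]
    · obtain ⟨x, l, w, hz⟩ := exists_eq_col_col Φ (col z e)
      obtain ⟨rfl, rfl⟩ := col_inj.1 hz
      rw [hΩ, hG.2, hG'.2, feedback_col, feedback_col, hωU]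
      change _ = col (Ω (col _ _)) _
      rw [hΩ]
      rfl
  · rintro ⟨Ω, ⟨hP, hU⟩, hid⟩
    have hsymm : ∀ h : M, Ω.symm (col h 0) = col h 0 := fun h => by
      rw [LinearIsometryEquiv.symm_apply_eq, hid]
    obtain ⟨ω, hω⟩ := exists_restrict (inrIsometry M W) (inrIsometry M W') Ω
      (fun w => ⟨(Ω (col 0 w)).snd, by
        have h1 : (Ω (col 0 w)).fst = 0 := ext_inner_left ℂ fun h => by
          rw [← inner_col_zero_left, ← hid, LinearIsometryEquiv.inner_map_map, inner_col]
          simp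
        exact eq_zero_col h1⟩)
      (fun w => ⟨(Ω.symm (col 0 w)).snd, by
        have h1 : (Ω.symm (col 0 w)).fst = 0 := ext_inner_left ℂ fun h => by
          rw [← inner_col_zero_left, ← hsymm, LinearIsometryEquiv.inner_map_map, inner_col]
          simp
        rw [inrIsometry_apply, inrIsometry_apply, ← eq_zero_col h1,
          LinearIsometryEquiv.apply_symm_apply]⟩)
    have hω' : ∀ h w, Ω (col h w) = col h (ω w) := fun h w => by
      have h1 : (col h w) = col h 0 + col 0 w := by rw [col_add_col, add_zero, zero_add]
      have h2 : Ω (col 0 w) = col 0 (ω w) := hω w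
      rw [h1, map_add, hid, h2, col_add_col, add_zero, zero_add]
    refine ⟨ω, fun k w => ?_, fun w l => ?_⟩
    · have := hP k (col 0 w)
      rw [hG.1, hω', hω', hG'.1] at this
      exact (col_inj.1 this).2
    · refine (loadInclusion W' Ψ).injective ?_
      rw [← hG'.apply_loadInclusion, loadInclusion_col, ← hω', hU, ← loadInclusion_col,
        hG.apply_loadInclusion, ← col_eta (Gt.U (col w l)), loadInclusion_col, loadInclusion_col,
        hω']
      rfl

end LoadProperties

/-! ### Feedback connections over complementary subspaces -/

section FeedbackConnection

variable {d : ℕ} {W W' M E F : Type*}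
  [NormedAddCommGroup W] [InnerProductSpace ℂ W] [CompleteSpace W]
  [NormedAddCommGroup W'] [InnerProductSpace ℂ W'] [CompleteSpace W']
  [NormedAddCommGroup M] [InnerProductSpace ℂ M] [CompleteSpace M]
  [NormedAddCommGroup E] [InnerProductSpace ℂ E] [NormedAddCommGroup F] [InnerProductSpace ℂ F]
  {D : Submodule ℂ (HSum M E)} {R : Submodule ℂ (HSum M F)} {L L' : Submodule ℂ M}

/-- The unitary operator `U₀` acts as `V` on `D`, and as the identity from `L` in the domain to the
summand `L` and from the summand `L'` to `L'` in the codomain. -/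
def ExtendsUnitary (V : D ≃ₗᵢ[ℂ] R) (U₀ : HSum (HSum M E) L' ≃ₗᵢ[ℂ] HSum (HSum M F) L) : Prop :=
  (∀ x : D, U₀ (col (x : HSum M E) 0) = col (V x : HSum M F) 0) ∧
  (∀ l : L, U₀ (col (col (l : M) 0) 0) = col 0 l) ∧
  (∀ l' : L', U₀ (col 0 l') = col (col (l' : M) 0) 0)

/-- `G` is a unitary extension of `V`, with the projections `Q k` on `M`. -/
def ExtendsOn (Q : Fin d → M →L[ℂ] M) (V : D ≃ₗᵢ[ℂ] R) (G : GRUnitary d (HSum M W) E F) : Prop :=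
  (∃ Pt : Fin d → W →L[ℂ] W, ∀ k h w, G.P k (col h w) = col (Q k h) (Pt k w)) ∧
  ∀ x : D, G.U (col (col (x : HSum M E).fst 0) (x : HSum M E).snd) =
    col (col (V x : HSum M F).fst 0) (V x : HSum M F).snd

/-- `G` is the feedback connection of `U₀` with the load `Gt`, with the projections `Q k` on
`M`. -/
def FeedbackConnected (Q : Fin d → M →L[ℂ] M)
    (U₀ : HSum (HSum M E) L' ≃ₗᵢ[ℂ] HSum (HSum M F) L)
    (Gt : GRUnitary d W L L') (G : GRUnitary d (HSum M W) E F) : Prop :=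
  (∀ k h w, G.P k (col h w) = col (Q k h) (Gt.P k w)) ∧
  ∀ h w e h' w' f, G.U (col (col h w) e) = col (col h' w') f ↔
    ∃! l : L × L', U₀ (col (col h e) l.2) = col (col h' f) l.1 ∧ Gt.U (col w l.1) = col w' l.2

variable {Q : Fin d → M →L[ℂ] M} [CompleteSpace D] [CompleteSpace R]

theorem existsUnique_extendsUnitary
    (hD : ∀ f e, col f e ∈ Dᗮ ↔ f ∈ L ∧ e = 0) (hR : ∀ f e, col f e ∈ Rᗮ ↔ f ∈ L' ∧ e = 0)
    (V : D ≃ₗᵢ[ℂ] R) :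
    ∃! U₀ : HSum (HSum M E) L' ≃ₗᵢ[ℂ] HSum (HSum M F) L, ExtendsUnitary V U₀ :=
  ⟨_, (eq_swapUnitary_iff hD hR V _).2 rfl, fun _ h => (eq_swapUnitary_iff hD hR V _).1 h⟩

variable {V : D ≃ₗᵢ[ℂ] R} {U₀ : HSum (HSum M E) L' ≃ₗᵢ[ℂ] HSum (HSum M F) L}

/-- The relational feedback connection is the unitary operator `feedback`. -/
theorem feedbackConnected_iff_isLoaded
    (hD : ∀ f e, col f e ∈ Dᗮ ↔ f ∈ L ∧ e = 0) (hR : ∀ f e, col f e ∈ Rᗮ ↔ f ∈ L' ∧ e = 0)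
    (hU₀ : ExtendsUnitary V U₀) {Gt : GRUnitary d W L L'}
    {G : GRUnitary d (HSum M W) E F} :
    FeedbackConnected Q U₀ Gt G ↔
      IsLoaded (complementUnitary D L hD) (complementUnitary R L' hR) V Q Gt G := by
  rw [FeedbackConnected, IsLoaded, (eq_swapUnitary_iff hD hR V _).1 hU₀]
  refine and_congr Iff.rfl ⟨fun h => LinearIsometryEquiv.ext fun z => ?_, fun h => ?_⟩
  · obtain ⟨⟨y, w⟩, e⟩ := z
    change G.U (col (col y w) e) = feedback _ _ _ _ (col (col y w) e)
    exact ((h y w e _ _ _).2 ((feedback_eq_iff _ _ _ _ _ _ _ _ _ _).1 rfl))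
  · intro y w e y' w' f
    rw [h, feedback_eq_iff]

theorem extendsOn_iff
    (hD : ∀ f e, col f e ∈ Dᗮ ↔ f ∈ L ∧ e = 0) (hR : ∀ f e, col f e ∈ Rᗮ ↔ f ∈ L' ∧ e = 0)
    {G : GRUnitary d (HSum M W) E F} :
    ExtendsOn Q V G ↔ (∃ Pt : Fin d → W →L[ℂ] W, ∀ k h w,
      G.P k (col h w) = col (Q k h) (Pt k w)) ∧
      ∀ x, G.U (col (col (complementUnitary D L hD (col x 0)).fst 0)
          (complementUnitary D L hD (col x 0)).snd) =
        col (col (complementUnitary R L' hR (col (V x) 0)).fst 0)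
          (complementUnitary R L' hR (col (V x) 0)).snd := by
  simp only [complementUnitary_col_zero]
  rfl

theorem existsUnique_feedbackConnected
    (hD : ∀ f e, col f e ∈ Dᗮ ↔ f ∈ L ∧ e = 0) (hR : ∀ f e, col f e ∈ Rᗮ ↔ f ∈ L' ∧ e = 0)
    (hQ : ∀ k, IsStarProjection (Q k))
    (hQo : ∀ j k, j ≠ k → Q j ∘L Q k = 0) (hQs : ∑ k, Q k = 1) (hU₀ : ExtendsUnitary V U₀)
    (Gt : GRUnitary d W L L') :
    ∃! G : GRUnitary d (HSum M W) E F, FeedbackConnected Q U₀ Gt G := by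
  simp only [feedbackConnected_iff_isLoaded hD hR hU₀]
  exact existsUnique_isLoaded hQ hQo hQs Gt

theorem ExtendsOn.existsUnique_load
    (hD : ∀ f e, col f e ∈ Dᗮ ↔ f ∈ L ∧ e = 0) (hR : ∀ f e, col f e ∈ Rᗮ ↔ f ∈ L' ∧ e = 0)
    (hU₀ : ExtendsUnitary V U₀) {G : GRUnitary d (HSum M W) E F}
    (hG : ExtendsOn Q V G) : ∃! Gt : GRUnitary d W L L', FeedbackConnected Q U₀ Gt G := by
  simp only [feedbackConnected_iff_isLoaded hD hR hU₀]
  obtain ⟨⟨Pt, hPt⟩, hU⟩ := (extendsOn_iff hD hR).1 hG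
  exact GivoneRoesser.existsUnique_load Pt G hPt hU

theorem FeedbackConnected.extendsOn
    (hD : ∀ f e, col f e ∈ Dᗮ ↔ f ∈ L ∧ e = 0) (hR : ∀ f e, col f e ∈ Rᗮ ↔ f ∈ L' ∧ e = 0)
    (hU₀ : ExtendsUnitary V U₀) {Gt : GRUnitary d W L L'}
    {G : GRUnitary d (HSum M W) E F} (h : FeedbackConnected Q U₀ Gt G) : ExtendsOn Q V G := by
  rw [extendsOn_iff hD hR]
  have hl := (feedbackConnected_iff_isLoaded hD hR hU₀).1 h
  refine ⟨⟨Gt.P, h.1⟩, fun x => ?_⟩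
  rw [hl.2, feedback_col, show (col (0 : W) (0 : L)) = 0 from rfl, map_zero]
  rfl

theorem FeedbackConnected.op_eq_explicitParam
    (hD : ∀ f e, col f e ∈ Dᗮ ↔ f ∈ L ∧ e = 0) (hR : ∀ f e, col f e ∈ Rᗮ ↔ f ∈ L' ∧ e = 0)
    (hU₀ : ExtendsUnitary V U₀)
    {Gt : GRUnitary d W L L'} {G : GRUnitary d (HSum M W) E F} (h : FeedbackConnected Q U₀ Gt G) :
    G.op = explicitParam (U₀.toContinuousLinearEquiv :
      HSum (HSum M E) L' →L[ℂ] HSum (HSum M F) L) Gt.op := by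
  refine ContinuousLinearMap.ext fun z => ?_
  rw [explicitParam_eq_feedback (complementUnitary D L hD) (complementUnitary R L' hR) V Gt.U _
    (fun z => DFunLike.congr_fun ((eq_swapUnitary_iff hD hR V _).1 hU₀) z) Gt.op fun z => rfl]
  exact DFunLike.congr_fun ((feedbackConnected_iff_isLoaded hD hR hU₀).1 h).2 z

theorem FeedbackConnected.closelyConnected_iff [CompleteSpace L] [CompleteSpace L']
    (hD : ∀ f e, col f e ∈ Dᗮ ↔ f ∈ L ∧ e = 0) (hR : ∀ f e, col f e ∈ Rᗮ ↔ f ∈ L' ∧ e = 0)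
   
    (hU₀ : ExtendsUnitary V U₀) {Gt : GRUnitary d W L L'} {G : GRUnitary d (HSum M W) E F}
    (h : FeedbackConnected Q U₀ Gt G) :
    Gt.CloselyConnected ↔
      ¬ ∃ N : Submodule ℂ (HSum M W), N ≠ ⊥ ∧ IsClosed (N : Set (HSum M W)) ∧
        (∀ x ∈ N, x.fst = 0) ∧
        (fun x => G.U (col x 0)) '' (N : Set (HSum M W)) =
          (fun x => col x 0) '' (N : Set (HSum M W)) ∧
        ∀ k, ∀ x ∈ N, G.P k x ∈ N :=
  ((feedbackConnected_iff_isLoaded hD hR hU₀).1 h).closelyConnected_iff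

theorem FeedbackConnected.unitarilyEquivalent_iff
    (hD : ∀ f e, col f e ∈ Dᗮ ↔ f ∈ L ∧ e = 0) (hR : ∀ f e, col f e ∈ Rᗮ ↔ f ∈ L' ∧ e = 0)
    (hU₀ : ExtendsUnitary V U₀)
    {Gt : GRUnitary d W L L'} {Gt' : GRUnitary d W' L L'}
    {G : GRUnitary d (HSum M W) E F} {G' : GRUnitary d (HSum M W') E F}
    (h : FeedbackConnected Q U₀ Gt G) (h' : FeedbackConnected Q U₀ Gt' G') :
    Gt.UnitarilyEquivalent Gt' ↔
      ∃ ω : HSum M W ≃ₗᵢ[ℂ] HSum M W', GRUnitary.EquivVia ω G G' ∧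
        ∀ h : M, ω (col h 0) = col h 0 :=
  ((feedbackConnected_iff_isLoaded hD hR hU₀).1 h).unitarilyEquivalent_iff
    ((feedbackConnected_iff_isLoaded hD hR hU₀).1 h')

end FeedbackConnection

/-! ### The model space of an augmented Agler decomposition -/

namespace AugAglerDecomposition

variable {d : ℕ} {E Es : Type*}
  [NormedAddCommGroup E] [InnerProductSpace ℂ E] [CompleteSpace E]
  [NormedAddCommGroup Es] [InnerProductSpace ℂ Es] [CompleteSpace Es]
  {S : (Fin d →₀ ℕ) → E →L[ℂ] Es} (𝒦 : AugAglerDecomposition S)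

theorem kerFun_apply (k : Fin d) (n m : Fin d → ℤ) (u : HSum Es E) :
    RKHS.kerFun (𝒦.H k) m u n = 𝒦.K k n m u := by
  rw [RKHS.kerFun_apply, FRKHS.kernel_eq]

theorem inner_kerFun_kerFun (k : Fin d) (n m : Fin d → ℤ) (v u : HSum Es E) :
    ⟪RKHS.kerFun (𝒦.H k) n v, RKHS.kerFun (𝒦.H k) m u⟫ = ⟪v, 𝒦.K k n m u⟫ := by
  rw [RKHS.kerFun_inner, kerFun_apply]

theorem kerFun_fst_eq_zero (k : Fin d) {n : Fin d → ℤ} (hn : ¬ ∀ j, 0 ≤ n j) (es : Es) :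
    RKHS.kerFun (𝒦.H k) n (col es 0) = 0 := by
  rw [← inner_self_eq_zero (𝕜 := ℂ), inner_kerFun_kerFun, inner_eq_fst_add_snd]
  simp [𝒦.support_fst k n n _ hn]

theorem kerFun_snd_eq_zero (k : Fin d) {n : Fin d → ℤ} (hn : ¬ ∀ j, (n + unitIdx k) j ≤ 0)
    (e : E) : RKHS.kerFun (𝒦.H k) n (col 0 e) = 0 := by
  rw [← inner_self_eq_zero (𝕜 := ℂ), inner_kerFun_kerFun, inner_eq_fst_add_snd]
  simp [𝒦.support_snd k n n _ hn]

/-- The support condition passes from the kernel to the elements of its space, by the reproducing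
property. -/
theorem apply_fst_eq_zero {k : Fin d} (f : 𝒦.H k) {n : Fin d → ℤ} (hn : ¬ ∀ j, 0 ≤ n j) :
    (f n).fst = 0 := by
  refine ext_inner_left ℂ fun es => ?_
  have h := RKHS.kerFun_inner n (col es (0 : E)) f
  rw [kerFun_fst_eq_zero _ _ hn, inner_zero_left, inner_eq_fst_add_snd] at h
  simpa using h.symm

theorem apply_snd_eq_zero {k : Fin d} (f : 𝒦.H k) {n : Fin d → ℤ}
    (hn : ¬ ∀ j, (n + unitIdx k) j ≤ 0) : (f n).snd = 0 := by
  refine ext_inner_left ℂ fun e => ?_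
  have h := RKHS.kerFun_inner n (col (0 : Es) e) f
  rw [kerFun_snd_eq_zero _ _ hn, inner_zero_left, inner_eq_fst_add_snd] at h
  simpa using h.symm

/-- The identity of the decomposition, as equality of Gram matrices. -/
theorem inner_genD_genD (n m : Fin d → ℤ) (v u : HSum Es E) :
    ⟪𝒦.genD n v, 𝒦.genD m u⟫ = ⟪𝒦.genR n v, 𝒦.genR m u⟫ := by
  have key := (congrArg (fun x => ⟪v, x⟫) (𝒦.identity n m u.fst u.snd)).trans
    (inner_col_right v _ _)
  simp only [inner_sum, _root_.sub_apply, inner_sub_right, Finset.sum_sub_distrib, col_eta] at key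
  simp only [genD, genR, inner_col, PiLp.inner_apply, inner_kerFun_kerFun]
  rw [← sub_eq_zero, add_sub_add_comm, key]
  have he : ⟪laurent S m (ContinuousLinearMap.adjoint (laurent S n) v.fst), u.fst⟫ =
      ⟪v.fst, laurent S n (ContinuousLinearMap.adjoint (laurent S m) u.fst)⟫ := by
    rw [← ContinuousLinearMap.adjoint_inner_right, ContinuousLinearMap.adjoint_inner_left]
  simp only [inner_add_left, inner_add_right, inner_sub_right, inner_smul_left, inner_smul_right,
    ContinuousLinearMap.adjoint_inner_left, ContinuousLinearMap.adjoint_inner_right, map_add,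
    map_smul, he]
  have hd : ∀ n : Fin d → ℤ, (starRingEnd ℂ) (delta n) = delta n := fun n => by
    unfold delta; split_ifs <;> simp
  simp only [hd]
  ring

theorem existsUnique_isV : ∃! V : 𝒦.domD ≃ₗᵢ[ℂ] 𝒦.ranR, 𝒦.IsV V := by
  obtain ⟨V, hV, hu⟩ := existsUnique_unitary_of_gram
    (fun p : (Fin d → ℤ) × HSum Es E => 𝒦.genD p.1 p.2)
    (fun p : (Fin d → ℤ) × HSum Es E => 𝒦.genR p.1 p.2)
    (fun i j => 𝒦.inner_genD_genD _ _ _ _) (fun i => 𝒦.genD_mem _ _) (fun i => 𝒦.genR_mem _ _)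
  exact ⟨V, fun m u => hV (m, u), fun V' hV' => hu V' fun i => hV' i.1 i.2⟩

theorem sumMap_apply (f : 𝒦.Model) (n : Fin d → ℤ) : 𝒦.sumMap f n = ∑ k, f k n := by
  simp [sumMap]

theorem shiftedSumMap_apply (f : 𝒦.Model) (n : Fin d → ℤ) :
    𝒦.shiftedSumMap f n = ∑ k, f k (n - unitIdx k) := by
  simp [shiftedSumMap]

theorem mem_L {f : 𝒦.Model} : f ∈ 𝒦.L ↔ ∀ n, ∑ k, f k n = 0 := by
  simp [L, ← sumMap_apply, funext_iff]

theorem mem_L' {f : 𝒦.Model} : f ∈ 𝒦.L' ↔ ∀ n, ∑ k, f k (n - unitIdx k) = 0 := by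
  simp [L', ← shiftedSumMap_apply, funext_iff]

theorem inner_genD (m : Fin d → ℤ) (u : HSum Es E) (f : 𝒦.Model) (e : E) :
    ⟪𝒦.genD m u, col f e⟫ = ⟪u, ∑ k, f k m⟫ + ⟪u, col (laurent S m e) (delta m • e)⟫ := by
  have hd : (starRingEnd ℂ) (delta m) = delta m := by
    unfold delta; split_ifs <;> simp
  rw [genD, inner_col, PiLp.inner_apply, inner_sum]
  congr 1
  · exact Finset.sum_congr rfl fun k _ => RKHS.kerFun_inner _ _ _
  · rw [inner_eq_fst_add_snd, inner_add_left, ContinuousLinearMap.adjoint_inner_left,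
      inner_smul_left, hd]
    simp

theorem inner_genR (m : Fin d → ℤ) (u : HSum Es E) (f : 𝒦.Model) (es : Es) :
    ⟪𝒦.genR m u, col f es⟫ = ⟪u, ∑ k, f k (m - unitIdx k)⟫ +
      ⟪u, col (delta m • es) (ContinuousLinearMap.adjoint (laurent S (-m)) es)⟫ := by
  have hd : (starRingEnd ℂ) (delta m) = delta m := by
    unfold delta; split_ifs <;> simp
  rw [genR, inner_col, PiLp.inner_apply, inner_sum]
  congr 1
  · exact Finset.sum_congr rfl fun k _ => RKHS.kerFun_inner _ _ _
  · rw [inner_eq_fst_add_snd, inner_add_left, ← ContinuousLinearMap.adjoint_inner_right,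
      inner_smul_left, hd]
    simp

theorem mem_domD_orthogonal_iff {x : HSum 𝒦.Model E} :
    x ∈ 𝒦.domDᗮ ↔ ∀ m u, ⟪𝒦.genD m u, x⟫ = 0 :=
  (mem_orthogonal_topologicalClosure_span_iff _).trans Prod.forall

theorem mem_ranR_orthogonal_iff {x : HSum 𝒦.Model Es} :
    x ∈ 𝒦.ranRᗮ ↔ ∀ m u, ⟪𝒦.genR m u, x⟫ = 0 :=
  (mem_orthogonal_topologicalClosure_span_iff _).trans Prod.forall

/-- The support conditions force the input component of a vector orthogonal to `𝓓` to vanish: at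
`m = 0` every `f_k` contributes nothing to the second component of the sum. -/
theorem mem_domD_orthogonal {f : 𝒦.Model} {e : E} :
    col f e ∈ 𝒦.domDᗮ ↔ f ∈ 𝒦.L ∧ e = 0 := by
  rw [mem_domD_orthogonal_iff, mem_L]
  simp only [inner_genD, ← inner_add_right]
  constructor
  · intro h
    have h' : ∀ m, ∑ k, f k m + col (laurent S m e) (delta m • e) = 0 := fun m =>
      ext_inner_left ℂ fun u => by rw [h, inner_zero_right]
    have he : e = 0 := by
      have h0 := congrArg (WithLp.sndL 2 ℂ Es E) (h' 0)
      rw [map_add, map_sum, Finset.sum_eq_zero, map_zero] at h0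
      · simpa [delta] using h0
      · intro k _
        refine 𝒦.apply_snd_eq_zero (f k) fun hk => ?_
        have := hk k
        simp at this
    subst he
    refine ⟨fun n => ?_, rfl⟩
    have := h' n
    rwa [map_zero, smul_zero, show (col (0 : Es) (0 : E)) = 0 from rfl, add_zero] at this
  · rintro ⟨h, rfl⟩ m u
    rw [h, map_zero, smul_zero, zero_add]
    exact inner_zero_right _

/-- As for `mem_domD_orthogonal`; here every `z_k f_k` contributes nothing to the first component at
`m = 0`. -/
theorem mem_ranR_orthogonal {f : 𝒦.Model} {es : Es} :
    col f es ∈ 𝒦.ranRᗮ ↔ f ∈ 𝒦.L' ∧ es = 0 := by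
  rw [mem_ranR_orthogonal_iff, mem_L']
  simp only [inner_genR, ← inner_add_right]
  constructor
  · intro h
    have h' : ∀ m, ∑ k, f k (m - unitIdx k) + col (delta m • es)
        (ContinuousLinearMap.adjoint (laurent S (-m)) es) = 0 := fun m =>
      ext_inner_left ℂ fun u => by rw [h, inner_zero_right]
    have he : es = 0 := by
      have h0 := congrArg (WithLp.fstL 2 ℂ Es E) (h' 0)
      rw [map_add, map_sum, Finset.sum_eq_zero, map_zero] at h0
      · simpa [delta] using h0
      · intro k _
        refine 𝒦.apply_fst_eq_zero (f k) fun hk => ?_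
        have := hk k
        simp at this
    subst he
    refine ⟨fun n => ?_, rfl⟩
    have := h' n
    rwa [map_zero, smul_zero, show (col (0 : Es) (0 : E)) = 0 from rfl, add_zero] at this
  · rintro ⟨h, rfl⟩ m u
    rw [h, map_zero, smul_zero, zero_add]
    exact inner_zero_right _

instance : CompleteSpace 𝒦.domD := (Submodule.isClosed_topologicalClosure _).completeSpace_coe

instance : CompleteSpace 𝒦.ranR := (Submodule.isClosed_topologicalClosure _).completeSpace_coe

section FeedbackConnection

variable {𝒦}
variable {Ht : Type*} [NormedAddCommGroup Ht] [InnerProductSpace ℂ Ht] [CompleteSpace Ht]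
   {U₀ : HSum (HSum 𝒦.Model E) 𝒦.L' ≃ₗᵢ[ℂ] HSum (HSum 𝒦.Model Es) 𝒦.L}
  {V : 𝒦.domD ≃ₗᵢ[ℂ] 𝒦.ranR}

theorem existsUnique_isU₀ (V : 𝒦.domD ≃ₗᵢ[ℂ] 𝒦.ranR) :
    ∃! U₀ : HSum (HSum 𝒦.Model E) 𝒦.L' ≃ₗᵢ[ℂ] HSum (HSum 𝒦.Model Es) 𝒦.L, 𝒦.IsU₀ V U₀ :=
  existsUnique_extendsUnitary (M := 𝒦.Model) (E := E) (F := Es) (D := 𝒦.domD) (R := 𝒦.ranR)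
    (L := 𝒦.L) (L' := 𝒦.L') (fun _ _ => 𝒦.mem_domD_orthogonal) (fun _ _ => 𝒦.mem_ranR_orthogonal) V

theorem existsUnique_isFeedback (h : 𝒦.IsU₀ V U₀) (Gt : GRUnitary d Ht 𝒦.L 𝒦.L') :
    ∃! G : GRUnitary d (HSum 𝒦.Model Ht) E Es, IsFeedback U₀ Gt G :=
  existsUnique_feedbackConnected (M := 𝒦.Model) (E := E) (F := Es) (D := 𝒦.domD) (R := 𝒦.ranR)
    (L := 𝒦.L) (L' := 𝒦.L') (fun _ _ => 𝒦.mem_domD_orthogonal) (fun _ _ => 𝒦.mem_ranR_orthogonal)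
    (isStarProjection_coordProj 𝒦.H) (coordProj_comp_of_ne 𝒦.H) (sum_coordProj 𝒦.H) h Gt

theorem existsUnique_load (h : 𝒦.IsU₀ V U₀) (G : GRUnitary d (HSum 𝒦.Model Ht) E Es)
    (hG : IsExtension V G) : ∃! Gt : GRUnitary d Ht 𝒦.L 𝒦.L', IsFeedback U₀ Gt G :=
  ExtendsOn.existsUnique_load (M := 𝒦.Model) (E := E) (F := Es) (D := 𝒦.domD) (R := 𝒦.ranR)
    (L := 𝒦.L) (L' := 𝒦.L') (Q := coordProj 𝒦.H)
    (fun _ _ => 𝒦.mem_domD_orthogonal) (fun _ _ => 𝒦.mem_ranR_orthogonal) h hG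

theorem IsFeedback.isExtension (h : 𝒦.IsU₀ V U₀) {Gt : GRUnitary d Ht 𝒦.L 𝒦.L'}
    {G : GRUnitary d (HSum 𝒦.Model Ht) E Es} (hG : IsFeedback U₀ Gt G) : IsExtension V G :=
  FeedbackConnected.extendsOn (M := 𝒦.Model) (E := E) (F := Es) (D := 𝒦.domD) (R := 𝒦.ranR)
    (L := 𝒦.L) (L' := 𝒦.L') (Q := coordProj 𝒦.H)
    (fun _ _ => 𝒦.mem_domD_orthogonal) (fun _ _ => 𝒦.mem_ranR_orthogonal) h hG

theorem IsFeedback.op_eq_explicitParam (h : 𝒦.IsU₀ V U₀) {Gt : GRUnitary d Ht 𝒦.L 𝒦.L'}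
    {G : GRUnitary d (HSum 𝒦.Model Ht) E Es} (hG : IsFeedback U₀ Gt G) :
    G.op = explicitParam (opU₀ U₀) Gt.op :=
  FeedbackConnected.op_eq_explicitParam (M := 𝒦.Model) (E := E) (F := Es) (D := 𝒦.domD)
    (R := 𝒦.ranR) (L := 𝒦.L) (L' := 𝒦.L') (Q := coordProj 𝒦.H)
    (fun _ _ => 𝒦.mem_domD_orthogonal) (fun _ _ => 𝒦.mem_ranR_orthogonal) h hG

theorem IsFeedback.closelyConnected_iff (h : 𝒦.IsU₀ V U₀) {Gt : GRUnitary d Ht 𝒦.L 𝒦.L'}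
    {G : GRUnitary d (HSum 𝒦.Model Ht) E Es} (hG : IsFeedback U₀ Gt G) :
    Gt.CloselyConnected ↔
          ¬ ∃ M : Submodule ℂ (HSum 𝒦.Model Ht), M ≠ ⊥ ∧
            IsClosed (M : Set (HSum 𝒦.Model Ht)) ∧
            (∀ x ∈ M, x.fst = 0) ∧
            (fun x => G.U (col x 0)) '' (M : Set (HSum 𝒦.Model Ht)) =
              (fun x => col x 0) '' (M : Set (HSum 𝒦.Model Ht)) ∧
            ∀ k, ∀ x ∈ M, G.P k x ∈ M :=
  FeedbackConnected.closelyConnected_iff (M := 𝒦.Model) (E := E) (F := Es) (D := 𝒦.domD)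
    (R := 𝒦.ranR) (L := 𝒦.L) (L' := 𝒦.L') (Q := coordProj 𝒦.H)
    (fun _ _ => 𝒦.mem_domD_orthogonal) (fun _ _ => 𝒦.mem_ranR_orthogonal) h hG

theorem IsFeedback.unitarilyEquivalent_iff {Ht' : Type*} [NormedAddCommGroup Ht']
    [InnerProductSpace ℂ Ht'] [CompleteSpace Ht'] (h : 𝒦.IsU₀ V U₀)
    {Gt : GRUnitary d Ht 𝒦.L 𝒦.L'} {Gt' : GRUnitary d Ht' 𝒦.L 𝒦.L'}
    {G : GRUnitary d (HSum 𝒦.Model Ht) E Es} {G' : GRUnitary d (HSum 𝒦.Model Ht') E Es}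
    (hG : IsFeedback U₀ Gt G) (hG' : IsFeedback U₀ Gt' G') :
    Gt.UnitarilyEquivalent Gt' ↔
      ∃ ω : HSum 𝒦.Model Ht ≃ₗᵢ[ℂ] HSum 𝒦.Model Ht',
        GRUnitary.EquivVia ω G G' ∧ ∀ h : 𝒦.Model, ω (col h 0) = col h 0 :=
  FeedbackConnected.unitarilyEquivalent_iff (M := 𝒦.Model) (E := E) (F := Es) (D := 𝒦.domD)
    (R := 𝒦.ranR) (L := 𝒦.L) (L' := 𝒦.L') (Q := coordProj 𝒦.H)
    (fun _ _ => 𝒦.mem_domD_orthogonal) (fun _ _ => 𝒦.mem_ranR_orthogonal) h hG hG'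

end FeedbackConnection

end AugAglerDecomposition

/-! ### Laurent coefficients of resolvents -/

section LaurentCoefficients

variable {d : ℕ}

/-- A multi-index in the nonnegative orthant, as an integer multi-index. -/
def natIdx (n : Fin d →₀ ℕ) : Fin d → ℤ := fun k => n k

theorem natIdx_eq_zero {n : Fin d →₀ ℕ} : natIdx n = 0 ↔ n = 0 := by
  simp [natIdx, funext_iff, Finsupp.ext_iff]

theorem exists_natIdx {n : Fin d → ℤ} (hn : ∀ k, 0 ≤ n k) : ∃ m, n = natIdx m :=
  ⟨Finsupp.equivFunOnFinite.symm fun k => (n k).toNat, funext fun k => by simp [natIdx, hn k]⟩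

theorem natIdx_nonneg (n : Fin d →₀ ℕ) (k : Fin d) : 0 ≤ natIdx n k := Int.natCast_nonneg _

theorem laurent_natIdx {M : Type*} [Zero M] (a : (Fin d →₀ ℕ) → M) (n : Fin d →₀ ℕ) :
    laurent a (natIdx n) = a n := by
  rw [laurent, if_pos (natIdx_nonneg n)]
  congr 1
  ext k
  simp [natIdx]

theorem laurent_of_not_nonneg {M : Type*} [Zero M] (a : (Fin d →₀ ℕ) → M) {n : Fin d → ℤ}
    (hn : ¬ ∀ k, 0 ≤ n k) : laurent a n = 0 := if_neg hn

theorem sub_unitIdx_not_nonneg {n : Fin d → ℤ} (hn : ¬ ∀ k, 0 ≤ n k) (k : Fin d) :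
    ¬ ∀ j, 0 ≤ (n - unitIdx k) j := fun h => hn fun j => by
  have h1 := h j
  have h2 : (0 : ℤ) ≤ unitIdx k j := by
    by_cases hj : j = k <;> simp [unitIdx, hj]
  rw [Pi.sub_apply] at h1
  lia

theorem laurent_natIdx_sub {M : Type*} [Zero M] (a : (Fin d →₀ ℕ) → M) (n : Fin d →₀ ℕ)
    (k : Fin d) : laurent a (natIdx n - unitIdx k) =
      if Finsupp.single k 1 ≤ n then a (n - Finsupp.single k 1) else 0 := by
  split_ifs with h
  · rw [← laurent_natIdx a]
    congr 1
    funext j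
    have := h j
    by_cases hj : j = k
    · subst hj
      rw [Finsupp.single_eq_same] at this
      simp [natIdx, unitIdx, this]
    · simp [natIdx, unitIdx, hj]
  · refine laurent_of_not_nonneg a fun h' => h fun j => ?_
    have := h' j
    by_cases hj : j = k
    · subst hj
      simp [natIdx, unitIdx] at this
      simpa using this
    · simp [Ne.symm hj]

/-- A family of Laurent coefficients supported in the nonnegative orthant is determined by a linear
recursion along the unit multi-indices. -/
theorem eq_of_recursion {M : Type*} [AddCommMonoid M] {x y f : (Fin d → ℤ) → M} {T : Fin d → M → M}
    (hx : ∀ n, x n = f n + ∑ k, T k (x (n - unitIdx k)))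
    (hy : ∀ n, y n = f n + ∑ k, T k (y (n - unitIdx k)))
    (hx0 : ∀ n, (¬ ∀ k, 0 ≤ n k) → x n = 0) (hy0 : ∀ n, (¬ ∀ k, 0 ≤ n k) → y n = 0) : x = y := by
  have key : ∀ (N : ℕ) (n : Fin d → ℤ), ∑ j, n j < N → x n = y n := by
    intro N
    induction N with
    | zero =>
      intro n hn
      have h : ¬ ∀ k, 0 ≤ n k := fun h => by
        have := Finset.sum_nonneg fun j (_ : j ∈ Finset.univ) => h j
        push_cast at hn
        lia
      rw [hx0 n h, hy0 n h]
    | succ N ih =>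
      intro n hn
      rw [hx, hy]
      congr 1
      refine Finset.sum_congr rfl fun k _ => congrArg (T k) (ih _ ?_)
      simp only [Pi.sub_apply, Finset.sum_sub_distrib, unitIdx, Finset.sum_pi_single',
        Finset.mem_univ, if_true]
      push_cast at hn
      lia
  funext n
  refine key ((∑ j, n j).toNat + 1) n ?_
  push_cast
  lia

section Ring

variable {A : Type*} [Ring A] {φ : MvPowerSeries (Fin d) A} {b : Fin d → A}

theorem laurent_coeff_of_eq_left
    (h : φ = 1 + (∑ k, MvPowerSeries.monomial (Finsupp.single k 1) (b k)) * φ) (n : Fin d → ℤ) :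
    laurent (fun j => MvPowerSeries.coeff j φ) n = (if n = 0 then 1 else 0) +
      ∑ k, b k * laurent (fun j => MvPowerSeries.coeff j φ) (n - unitIdx k) := by
  by_cases hn : ∀ k, 0 ≤ n k
  · obtain ⟨m, rfl⟩ := exists_natIdx hn
    simp only [laurent_natIdx, laurent_natIdx_sub, natIdx_eq_zero]
    conv_lhs => rw [h, map_add, MvPowerSeries.coeff_one, Finset.sum_mul, map_sum]
    simp only [MvPowerSeries.coeff_monomial_mul, mul_ite, mul_zero]
  · have h0 : n ≠ 0 := fun h0 => hn fun k => by rw [h0]; rfl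
    rw [laurent_of_not_nonneg _ hn, if_neg h0, zero_add, Finset.sum_eq_zero]
    intro k _
    rw [laurent_of_not_nonneg _ (sub_unitIdx_not_nonneg hn k), mul_zero]

theorem laurent_coeff_of_eq_right
    (h : φ = 1 + φ * ∑ k, MvPowerSeries.monomial (Finsupp.single k 1) (b k)) (n : Fin d → ℤ) :
    laurent (fun j => MvPowerSeries.coeff j φ) n = (if n = 0 then 1 else 0) +
      ∑ k, laurent (fun j => MvPowerSeries.coeff j φ) (n - unitIdx k) * b k := by
  by_cases hn : ∀ k, 0 ≤ n k
  · obtain ⟨m, rfl⟩ := exists_natIdx hn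
    simp only [laurent_natIdx, laurent_natIdx_sub, natIdx_eq_zero]
    conv_lhs => rw [h, map_add, MvPowerSeries.coeff_one, Finset.mul_sum, map_sum]
    simp only [MvPowerSeries.coeff_mul_monomial, ite_mul, zero_mul]
  · have h0 : n ≠ 0 := fun h0 => hn fun k => by rw [h0]; rfl
    rw [laurent_of_not_nonneg _ hn, if_neg h0, zero_add, Finset.sum_eq_zero]
    intro k _
    rw [laurent_of_not_nonneg _ (sub_unitIdx_not_nonneg hn k), zero_mul]

end Ring

end LaurentCoefficients

namespace GRUnitary

variable {d : ℕ} {X E F : Type*}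
  [NormedAddCommGroup X] [InnerProductSpace ℂ X] [CompleteSpace X]
  [NormedAddCommGroup E] [InnerProductSpace ℂ E] [CompleteSpace E]
  [NormedAddCommGroup F] [InnerProductSpace ℂ F] [CompleteSpace F]
  (G : GRUnitary d X E F) (T : X →L[ℂ] X)

theorem zDiag_mul_C : G.zDiag * MvPowerSeries.C T =
    ∑ k, MvPowerSeries.monomial (Finsupp.single k 1) (G.P k * T) := by
  simp only [zDiag, Finset.sum_mul, ← MvPowerSeries.monomial_zero_eq_C_apply,
    MvPowerSeries.monomial_mul_monomial, add_zero]

theorem constantCoeff_one_sub_zDiag_mul_C :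
    MvPowerSeries.constantCoeff (1 - G.zDiag * MvPowerSeries.C T) =
      ((1 : (X →L[ℂ] X)ˣ) : X →L[ℂ] X) := by
  rw [zDiag_mul_C, map_sub, map_one, map_sum, Finset.sum_eq_zero, sub_zero, Units.val_one]
  intro k _
  rw [← MvPowerSeries.coeff_zero_eq_constantCoeff_apply, MvPowerSeries.coeff_monomial, if_neg]
  exact fun h => one_ne_zero (Finsupp.single_eq_zero.1 h.symm)

theorem resolvent_eq_left : G.resolvent T = 1 +
    (∑ k, MvPowerSeries.monomial (Finsupp.single k 1) (G.P k * T)) * G.resolvent T := by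
  have h := MvPowerSeries.mul_invOfUnit _ _ (G.constantCoeff_one_sub_zDiag_mul_C T)
  rw [sub_mul, one_mul, zDiag_mul_C, sub_eq_iff_eq_add] at h
  rw [resolvent, zDiag_mul_C]
  exact h

theorem resolvent_eq_right : G.resolvent T = 1 +
    G.resolvent T * ∑ k, MvPowerSeries.monomial (Finsupp.single k 1) (G.P k * T) := by
  have h := MvPowerSeries.invOfUnit_mul _ _ (G.constantCoeff_one_sub_zDiag_mul_C T)
  rw [mul_sub, mul_one, zDiag_mul_C, sub_eq_iff_eq_add] at h
  rw [resolvent, zDiag_mul_C]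
  exact h

/-- The Laurent coefficients of `(I - Z_diag(z) T)⁻¹`. -/
def res (n : Fin d → ℤ) : X →L[ℂ] X :=
  laurent (fun j => MvPowerSeries.coeff j (G.resolvent T)) n

theorem res_of_not_nonneg {n : Fin d → ℤ} (hn : ¬ ∀ k, 0 ≤ n k) : G.res T n = 0 :=
  laurent_of_not_nonneg _ hn

theorem res_eq_left (n : Fin d → ℤ) :
    G.res T n = delta n • 1 + ∑ k, G.P k * T * G.res T (n - unitIdx k) := by
  refine (laurent_coeff_of_eq_left (G.resolvent_eq_left T) n).trans ?_
  rw [delta, ite_smul, one_smul, zero_smul]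
  rfl

theorem res_eq_right (n : Fin d → ℤ) :
    G.res T n = delta n • 1 + ∑ k, G.res T (n - unitIdx k) * (G.P k * T) := by
  refine (laurent_coeff_of_eq_right (G.resolvent_eq_right T) n).trans ?_
  rw [delta, ite_smul, one_smul, zero_smul]
  rfl

theorem star_delta (n : Fin d → ℤ) : (starRingEnd ℂ) (delta n) = delta n := by
  unfold delta
  split_ifs <;> simp

theorem adjoint_P (k : Fin d) : ContinuousLinearMap.adjoint (G.P k) = G.P k :=
  (G.isStarProjection k).isSelfAdjoint

theorem P_P (k : Fin d) (x : X) : G.P k (G.P k x) = G.P k x :=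
  DFunLike.congr_fun (G.isStarProjection k).isIdempotentElem x

theorem P_P_of_ne {j k : Fin d} (h : j ≠ k) (x : X) : G.P j (G.P k x) = 0 :=
  DFunLike.congr_fun (G.orthogonal j k h) x

theorem sum_P (x : X) : ∑ k, G.P k x = x := by
  have := DFunLike.congr_fun G.sum_eq_one x
  rwa [_root_.sum_apply] at this

theorem P_sum (k : Fin d) (f : Fin d → X) : G.P k (∑ j, G.P j (f j)) = G.P k (f k) := by
  rw [map_sum, Finset.sum_eq_single k, P_P]
  · exact fun j _ hj => G.P_P_of_ne hj.symm _
  · simp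

/-- The recursion for the coefficients of `(I - T^* Z(z))⁻¹`. -/
theorem adjoint_res (n : Fin d → ℤ) (x : X) :
    ContinuousLinearMap.adjoint (G.res T n) x = delta n • x +
      ContinuousLinearMap.adjoint T
        (∑ k, G.P k (ContinuousLinearMap.adjoint (G.res T (n - unitIdx k)) x)) := by
  rw [res_eq_right, map_add, map_sum, map_smulₛₗ, star_delta, map_sum, _root_.add_apply,
    _root_.sum_apply]
  congr 1
  · rw [← ContinuousLinearMap.star_eq_adjoint, star_one]
    rfl
  · refine Finset.sum_congr rfl fun k _ => ?_
    rw [← ContinuousLinearMap.star_eq_adjoint, star_mul, star_mul,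
      ContinuousLinearMap.star_eq_adjoint, ContinuousLinearMap.star_eq_adjoint,
      ContinuousLinearMap.star_eq_adjoint, adjoint_P]
    rfl

theorem adjoint_res_of_not_nonneg {n : Fin d → ℤ} (hn : ¬ ∀ k, 0 ≤ n k) (x : X) :
    ContinuousLinearMap.adjoint (G.res T n) x = 0 := by
  rw [res_of_not_nonneg _ _ hn, map_zero, _root_.zero_apply]

/-- The identity `(I - Z T)⁻¹ Z = Z (I - T Z)⁻¹` for the operator pencil `Z`. -/
theorem sum_res_P (n : Fin d → ℤ) (x : X) :
    ∑ k, G.res T (n - unitIdx k) (G.P k x) =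
      ∑ k, G.P k (ContinuousLinearMap.adjoint
        (G.res (ContinuousLinearMap.adjoint T) (n - unitIdx k)) x) := by
  refine congrFun (eq_of_recursion (T := fun k y => G.P k (T y))
    (f := fun n => ∑ k, delta (n - unitIdx k) • G.P k x)
    (x := fun n => ∑ k, G.res T (n - unitIdx k) (G.P k x))
    (y := fun n => ∑ k, G.P k (ContinuousLinearMap.adjoint
        (G.res (ContinuousLinearMap.adjoint T) (n - unitIdx k)) x))
    (fun n => ?_) (fun n => ?_) (fun n hn => ?_) (fun n hn => ?_)) n
  · simp only [map_sum]
    rw [Finset.sum_comm, ← Finset.sum_add_distrib]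
    refine Finset.sum_congr rfl fun k _ => ?_
    rw [res_eq_left, _root_.add_apply, _root_.sum_apply]
    congr 1
    refine Finset.sum_congr rfl fun j _ => ?_
    rw [sub_right_comm]
    rfl
  · rw [← Finset.sum_add_distrib]
    refine Finset.sum_congr rfl fun k _ => ?_
    conv_lhs => rw [adjoint_res, map_add, map_smul, ContinuousLinearMap.adjoint_adjoint]
  · refine Finset.sum_eq_zero fun k _ => ?_
    rw [res_of_not_nonneg _ _ (sub_unitIdx_not_nonneg hn k), _root_.zero_apply]
  · refine Finset.sum_eq_zero fun k _ => ?_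
    rw [adjoint_res_of_not_nonneg _ _ (sub_unitIdx_not_nonneg hn k), map_zero]

end GRUnitary

/-! ### Transfer functions and kernel factors -/

namespace GRUnitary

variable {d : ℕ} {X E F : Type*}
  [NormedAddCommGroup X] [InnerProductSpace ℂ X] [CompleteSpace X]
  [NormedAddCommGroup E] [InnerProductSpace ℂ E] [CompleteSpace E]
  [NormedAddCommGroup F] [InnerProductSpace ℂ F] [CompleteSpace F]
  (G : GRUnitary d X E F)

theorem U_col (x : X) (e : E) : G.U (col x e) = col (G.A x + G.B e) (G.C x + G.D e) := by
  have h : G.U (col x e) = G.U (col x 0) + G.U (col 0 e) := by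
    rw [← map_add, col_add_col, add_zero, zero_add]
  rw [h]
  rfl

theorem U_eq_iff (x y : X) (e : E) (f : F) :
    G.U (col x e) = col y f ↔ y = G.A x + G.B e ∧ f = G.C x + G.D e := by
  rw [U_col, col_inj]
  exact and_congr eq_comm eq_comm

theorem U_symm_col (y : X) (f : F) : G.U.symm (col y f) =
    col (ContinuousLinearMap.adjoint G.A y + ContinuousLinearMap.adjoint G.C f)
      (ContinuousLinearMap.adjoint G.B y + ContinuousLinearMap.adjoint G.D f) := by
  refine ext_inner_left ℂ fun z => ?_
  rw [← LinearIsometryEquiv.inner_map_map G.U, G.U.apply_symm_apply, ← col_eta z, U_col, inner_col,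
    inner_col]
  simp only [inner_add_left, inner_add_right, ContinuousLinearMap.adjoint_inner_right]
  ring

theorem U_eq_iff_adjoint (x y : X) (e : E) (f : F) : G.U (col x e) = col y f ↔
    x = ContinuousLinearMap.adjoint G.A y + ContinuousLinearMap.adjoint G.C f ∧
      e = ContinuousLinearMap.adjoint G.B y + ContinuousLinearMap.adjoint G.D f := by
  rw [← LinearIsometryEquiv.eq_symm_apply, U_symm_col, col_inj]

theorem adjoint_kernelFactor (k : Fin d) (n : Fin d → ℤ) (u : HSum F E) :
    ContinuousLinearMap.adjoint (G.kernelFactor k n) u =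
      G.P k (ContinuousLinearMap.adjoint (G.res G.A n) (ContinuousLinearMap.adjoint G.C u.fst)) +
      G.P k (ContinuousLinearMap.adjoint
        (G.res (ContinuousLinearMap.adjoint G.A) (-(n + unitIdx k))) (G.B u.snd)) := by
  rw [kernelFactor, ← col_eta u, colOp_adjoint_apply, ContinuousLinearMap.adjoint_comp,
    ContinuousLinearMap.adjoint_comp, ContinuousLinearMap.adjoint_comp,
    ContinuousLinearMap.adjoint_comp, ContinuousLinearMap.adjoint_adjoint, adjoint_P]
  rfl

theorem P_adjoint_kernelFactor (k : Fin d) (n : Fin d → ℤ) (u : HSum F E) :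
    G.P k (ContinuousLinearMap.adjoint (G.kernelFactor k n) u) =
      ContinuousLinearMap.adjoint (G.kernelFactor k n) u := by
  rw [adjoint_kernelFactor, map_add, P_P, P_P]

theorem laurent_coeff_mul_zDiag (T : X →L[ℂ] X) (n : Fin d → ℤ) :
    laurent (fun j => MvPowerSeries.coeff j (G.resolvent T * G.zDiag)) n =
      ∑ k, G.res T (n - unitIdx k) * G.P k := by
  by_cases hn : ∀ k, 0 ≤ n k
  · obtain ⟨m, rfl⟩ := exists_natIdx hn
    simp only [res, laurent_natIdx, laurent_natIdx_sub, zDiag, Finset.mul_sum, map_sum,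
      MvPowerSeries.coeff_mul_monomial, ite_mul, zero_mul]
  · rw [laurent_of_not_nonneg _ hn, Finset.sum_eq_zero]
    intro k _
    rw [res_of_not_nonneg _ _ (sub_unitIdx_not_nonneg hn k), zero_mul]

/-- Realization in terms of Laurent coefficients. -/
theorem realizes_iff (S : (Fin d →₀ ℕ) → E →L[ℂ] F) : G.Realizes S ↔ ∀ n e,
    laurent S n e = delta n • G.D e + G.C (∑ k, G.res G.A (n - unitIdx k) (G.P k (G.B e))) := by
  have key : ∀ (n : Fin d →₀ ℕ) (e : E), ((if n = 0 then G.D else 0) +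
      G.C ∘L MvPowerSeries.coeff n (G.resolvent G.A * G.zDiag) ∘L G.B) e =
      delta (natIdx n) • G.D e +
        G.C (∑ k, G.res G.A (natIdx n - unitIdx k) (G.P k (G.B e))) := by
    intro n e
    have h := DFunLike.congr_fun (G.laurent_coeff_mul_zDiag G.A (natIdx n)) (G.B e)
    rw [laurent_natIdx, _root_.sum_apply] at h
    rw [_root_.add_apply, ContinuousLinearMap.comp_apply, ContinuousLinearMap.comp_apply, h, delta]
    simp only [natIdx_eq_zero]
    split_ifs
    · rw [one_smul]
      rfl
    · rw [zero_smul]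
      rfl
  constructor
  · intro h n e
    by_cases hn : ∀ k, 0 ≤ n k
    · obtain ⟨m, rfl⟩ := exists_natIdx hn
      rw [laurent_natIdx, h m, key]
    · have h0 : n ≠ 0 := fun h0 => hn fun k => by rw [h0]; rfl
      rw [laurent_of_not_nonneg _ hn, delta, if_neg h0, zero_smul, Finset.sum_eq_zero, map_zero]
      · exact (add_zero _).symm
      · intro k _
        rw [res_of_not_nonneg _ _ (sub_unitIdx_not_nonneg hn k), _root_.zero_apply]
  · intro h n
    ext1 e
    rw [key, ← h, laurent_natIdx]

theorem realizes_iff_adjoint (S : (Fin d →₀ ℕ) → E →L[ℂ] F) : G.Realizes S ↔ ∀ n f,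
    ContinuousLinearMap.adjoint (laurent S n) f = delta n • ContinuousLinearMap.adjoint G.D f +
      ContinuousLinearMap.adjoint G.B (∑ k, G.P k
        (ContinuousLinearMap.adjoint (G.res G.A (n - unitIdx k))
          (ContinuousLinearMap.adjoint G.C f))) := by
  rw [realizes_iff]
  refine forall_congr' fun n => ?_
  have key : ∀ e f, ⟪delta n • ContinuousLinearMap.adjoint G.D f +
      ContinuousLinearMap.adjoint G.B (∑ k, G.P k
        (ContinuousLinearMap.adjoint (G.res G.A (n - unitIdx k))
          (ContinuousLinearMap.adjoint G.C f))), e⟫ =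
      ⟪f, delta n • G.D e + G.C (∑ k, G.res G.A (n - unitIdx k) (G.P k (G.B e)))⟫ := by
    intro e f
    have hP : ∀ k x y, ⟪G.P k x, y⟫ = ⟪x, G.P k y⟫ := fun k x y => by
      conv_lhs => rw [← G.adjoint_P k, ContinuousLinearMap.adjoint_inner_left]
    simp only [inner_add_left, inner_add_right, inner_smul_left, inner_smul_right, star_delta,
      ContinuousLinearMap.adjoint_inner_left, sum_inner, hP]
    rw [map_sum, inner_sum]
  constructor
  · intro h f
    refine ext_inner_right ℂ fun e => ?_
    rw [key, ContinuousLinearMap.adjoint_inner_left, h]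
  · intro h e
    refine ext_inner_left ℂ fun f => ?_
    rw [← key, ← ContinuousLinearMap.adjoint_inner_left, h]

/-- A realization maps the generators built from its kernel factors in the same way as `V` maps the
generators of its domain. -/
theorem Realizes.apply_generator {G : GRUnitary d X E F} {S : (Fin d →₀ ℕ) → E →L[ℂ] F}
    (h : G.Realizes S) (m : Fin d → ℤ) (u : HSum F E) :
    G.U (col (∑ k, ContinuousLinearMap.adjoint (G.kernelFactor k m) u)
      (ContinuousLinearMap.adjoint (laurent S m) u.fst + delta m • u.snd)) =
    col (∑ k, ContinuousLinearMap.adjoint (G.kernelFactor k (m - unitIdx k)) u)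
      (delta m • u.fst + laurent S (-m) u.snd) := by
  have hneg : delta (-m) = delta m := by simp [delta]
  have h1 := (G.U_eq_iff_adjoint
    (∑ k, G.P k (ContinuousLinearMap.adjoint (G.res G.A m)
      (ContinuousLinearMap.adjoint G.C u.fst)))
    (∑ k, G.P k (ContinuousLinearMap.adjoint (G.res G.A (m - unitIdx k))
      (ContinuousLinearMap.adjoint G.C u.fst)))
    (ContinuousLinearMap.adjoint (laurent S m) u.fst) (delta m • u.fst)).2 ⟨by
      rw [sum_P, adjoint_res, map_smul, add_comm], by
      rw [(G.realizes_iff_adjoint S).1 h, map_smul, add_comm]⟩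
  have h2 := (G.U_eq_iff
    (∑ k, G.P k (ContinuousLinearMap.adjoint
        (G.res (ContinuousLinearMap.adjoint G.A) (-m - unitIdx k)) (G.B u.snd)))
    (∑ k, G.P k (ContinuousLinearMap.adjoint
        (G.res (ContinuousLinearMap.adjoint G.A) (-m)) (G.B u.snd)))
    (delta m • u.snd) (laurent S (-m) u.snd)).2 ⟨by
      conv_lhs => rw [sum_P, adjoint_res, hneg, ContinuousLinearMap.adjoint_adjoint, ← map_smul]
      rw [add_comm], by
      rw [(G.realizes_iff S).1 h, sum_res_P, hneg, map_smul, add_comm]⟩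
  have h3 := congrArg₂ (· + ·) h1 h2
  simp only [← map_add, col_add_col, ← Finset.sum_add_distrib] at h3
  simp only [adjoint_kernelFactor, sub_add_cancel, neg_add', ← map_add]
  exact h3

/-- Conversely, a family of vectors on which the colligation operator acts in this way consists of
the vectors given by the kernel factors: the support conditions make the recursions satisfied by
the two families uniquely solvable. -/
theorem realizes_of_apply_generator {S : (Fin d →₀ ℕ) → E →L[ℂ] F}
    (x : (Fin d → ℤ) → HSum F E → X)
    (hU : ∀ m u, G.U (col (x m u)
      (ContinuousLinearMap.adjoint (laurent S m) u.fst + delta m • u.snd)) =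
      col (∑ k, G.P k (x (m - unitIdx k) u)) (delta m • u.fst + laurent S (-m) u.snd))
    (hx : ∀ m f e, x m (col f e) = x m (col f 0) + x m (col 0 e))
    (hf : ∀ m f, (¬ ∀ j, 0 ≤ m j) → x m (col f 0) = 0)
    (he : ∀ k m e, (¬ ∀ j, (m + unitIdx k) j ≤ 0) → G.P k (x m (col 0 e)) = 0) :
    G.Realizes S ∧
      ∀ k m u, G.P k (x m u) = ContinuousLinearMap.adjoint (G.kernelFactor k m) u := by
  have hneg : ∀ m : Fin d → ℤ, delta (-m) = delta m := by simp [delta]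
  -- For `u = (f, 0)` the relation, read through `U^*`, is the recursion of `(I - A^* Z)⁻¹ C^* f`.
  have hxf : ∀ f, (fun m => x m (col f 0)) = fun m =>
      ContinuousLinearMap.adjoint (G.res G.A m) (ContinuousLinearMap.adjoint G.C f) := by
    intro f
    refine eq_of_recursion (T := fun k y => ContinuousLinearMap.adjoint G.A (G.P k y))
      (f := fun m => delta m • ContinuousLinearMap.adjoint G.C f) (fun m => ?_) (fun m => ?_)
      (fun m hm => hf m f hm) (fun m hm => G.adjoint_res_of_not_nonneg _ hm _)
    · have h := ((G.U_eq_iff_adjoint _ _ _ _).1 (hU m (col f 0))).1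
      rw [h, map_sum, WithLp.toLp_fst, WithLp.toLp_snd, map_zero, add_zero, map_smul, add_comm]
    · rw [adjoint_res, map_sum]
  -- For `u = (0, e)` the vectors shifted by `e_k` satisfy the recursion of `(I - A Z)⁻¹ B e`.
  have hxe : ∀ e, (fun m => ∑ k, G.P k (x (-m - unitIdx k) (col 0 e))) = fun m =>
      ContinuousLinearMap.adjoint (G.res (ContinuousLinearMap.adjoint G.A) m) (G.B e) := by
    intro e
    refine eq_of_recursion (T := fun k y => G.A (G.P k y))
      (f := fun m => delta m • G.B e) (fun m => ?_) (fun m => ?_)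
      (fun m hm => ?_) (fun m hm => G.adjoint_res_of_not_nonneg _ hm _)
    · have h := ((G.U_eq_iff _ _ _ _).1 (hU (-m) (col 0 e))).1
      simp only [P_sum]
      rw [h, ← map_sum]
      have hs : ∑ k, G.P k (x (-(m - unitIdx k) - unitIdx k) (col 0 e)) = x (-m) (col 0 e) := by
        simp only [neg_sub, sub_sub_cancel_left]
        exact G.sum_P _
      rw [hs, WithLp.toLp_fst, WithLp.toLp_snd, map_zero, zero_add, map_smul, hneg, add_comm]
    · conv_lhs => rw [adjoint_res, map_sum, ContinuousLinearMap.adjoint_adjoint]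
    · refine Finset.sum_eq_zero fun k _ => he k _ e fun h => hm fun j => ?_
      have := h j
      rw [sub_add_cancel, Pi.neg_apply] at this
      lia
  refine ⟨(G.realizes_iff_adjoint S).2 fun m f => ?_, fun k m u => ?_⟩
  · have h := ((G.U_eq_iff_adjoint _ _ _ _).1 (hU m (col f 0))).2
    simp only [WithLp.toLp_fst, WithLp.toLp_snd, smul_zero, add_zero, map_zero, map_smul] at h
    rw [h, add_comm]
    have hk : ∀ k, x (m - unitIdx k) (col f 0) = _ := fun k => congrFun (hxf f) (m - unitIdx k)
    simp only [hk]
  · rw [adjoint_kernelFactor, ← col_eta u, hx, map_add]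
    congr 1
    · exact congrArg _ (congrFun (hxf _) m)
    · rw [← congrFun (hxe _) (-(m + unitIdx k))]
      simp only [P_sum, neg_neg, add_sub_cancel_right]
      rfl

end GRUnitary

/-! ### Unitary extensions and compatible realizations -/

section Transport

variable {d : ℕ} {X : Type w} {M E F : Type*}
  [NormedAddCommGroup X] [InnerProductSpace ℂ X] [CompleteSpace X]
  [NormedAddCommGroup M] [InnerProductSpace ℂ M] [CompleteSpace M]
  [NormedAddCommGroup E] [InnerProductSpace ℂ E] [CompleteSpace E]
  [NormedAddCommGroup F] [InnerProductSpace ℂ F] [CompleteSpace F]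

/-- The colligation obtained from `G` by a unitary change of the state space. -/
def GRUnitary.transport {X' : Type*} [NormedAddCommGroup X'] [InnerProductSpace ℂ X']
    [CompleteSpace X'] (G : GRUnitary d X E F) (ω : X' ≃ₗᵢ[ℂ] X) : GRUnitary d X' E F where
  P k := (ω.symm.toContinuousLinearEquiv : X →L[ℂ] X') ∘L G.P k ∘L
    (ω.toContinuousLinearEquiv : X' →L[ℂ] X)
  isStarProjection k := by
    refine ⟨?_, ?_⟩
    · ext1 x
      change ω.symm (G.P k (ω (ω.symm (G.P k (ω x))))) = ω.symm (G.P k (ω x))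
      rw [ω.apply_symm_apply, G.P_P]
    · rw [ContinuousLinearMap.isSelfAdjoint_iff_isSymmetric]
      intro x y
      change ⟪ω.symm (G.P k (ω x)), y⟫ = ⟪x, ω.symm (G.P k (ω y))⟫
      rw [← ω.inner_map_map, ← ω.inner_map_map x, ω.apply_symm_apply, ω.apply_symm_apply]
      exact (ContinuousLinearMap.isSelfAdjoint_iff_isSymmetric.1
        (G.isStarProjection k).isSelfAdjoint) _ _
  orthogonal j k hjk := by
    ext1 x
    change ω.symm (G.P j (ω (ω.symm (G.P k (ω x))))) = 0
    rw [ω.apply_symm_apply, G.P_P_of_ne hjk, map_zero]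
  sum_eq_one := by
    ext1 x
    rw [_root_.sum_apply]
    change ∑ k, ω.symm (G.P k (ω x)) = x
    rw [← map_sum, G.sum_P, ω.symm_apply_apply]
  U := ((LinearIsometryEquiv.withLpProdCongr 2 ω (.refl ℂ E)).trans G.U).trans
    (LinearIsometryEquiv.withLpProdCongr 2 ω.symm (.refl ℂ F))

/-- A colligation whose state space contains an isometric copy of `M`, reducing for the
projections, is unitarily equivalent to one on `M ⊕ W` for the orthogonal complement `W`. -/
theorem GRUnitary.exists_equiv_sum (G : GRUnitary d X E F) (J : M →ₗᵢ[ℂ] X)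
    (Q : Fin d → M →L[ℂ] M) (hQ : ∀ k h, G.P k (J h) = J (Q k h)) :
    ∃ (W : Type w) (_ : NormedAddCommGroup W) (_ : InnerProductSpace ℂ W) (_ : CompleteSpace W)
      (G' : GRUnitary d (HSum M W) E F) (ω : X ≃ₗᵢ[ℂ] HSum M W), GRUnitary.EquivVia ω G G' ∧
      (∀ h, ω (J h) = col h 0) ∧
      ∃ Pt : Fin d → W →L[ℂ] W, ∀ k h w, G'.P k (col h w) = col (Q k h) (Pt k w) := by
  let N : Submodule ℂ X := (LinearMap.range J.toLinearMap)ᗮ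
  have hc : IsComplete ((LinearMap.range J.toLinearMap : Submodule ℂ X) : Set X) := by
    rw [LinearMap.coe_range]
    exact J.isometry.isUniformInducing.isComplete_range
  have : CompleteSpace (LinearMap.range J.toLinearMap) := hc.completeSpace_coe
  have hJN : ∀ h, ∀ x ∈ N, ⟪J h, x⟫ = 0 := fun h x hx => hx _ ⟨h, rfl⟩
  let ω : HSum M N ≃ₗᵢ[ℂ] X := orthogonalSum J N.subtypeₗᵢ (fun h x => hJN h x x.2) fun z => by
    obtain ⟨_, ⟨h, rfl⟩, y, hy, rfl⟩ :=
      (LinearMap.range J.toLinearMap).exists_add_mem_mem_orthogonal z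
    exact ⟨h, ⟨y, hy⟩, rfl⟩
  have hω : ∀ h (w : N), ω (col h w) = J h + w := fun h w => orthogonalSum_col _ _ _ _ _ _
  have hω0 : ∀ h, ω (col h 0) = J h := fun h => by rw [hω]; exact add_zero _
  have hPN : ∀ k, ∀ x ∈ N, G.P k x ∈ N := fun k x hx => by
    rintro _ ⟨h, rfl⟩
    change ⟪J h, G.P k x⟫ = 0
    have h1 := (ContinuousLinearMap.isSelfAdjoint_iff_isSymmetric.1
      (G.isStarProjection k).isSelfAdjoint) (J h) x
    rw [ContinuousLinearMap.coe_coe, hQ] at h1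
    rw [← h1]
    exact hJN _ _ hx
  refine ⟨N, inferInstance, inferInstance, inferInstance, G.transport ω, ω.symm, ⟨fun k x => ?_,
    fun x e => ?_⟩, fun h => ?_, fun k => (G.P k ∘L N.subtypeL).codRestrict N
      fun x => hPN k x x.2, fun k h w => ?_⟩
  · change _ = ω.symm (G.P k (ω (ω.symm x)))
    rw [ω.apply_symm_apply]
  · change col (ω.symm (G.U (col (ω (ω.symm x)) e)).fst) (G.U (col (ω (ω.symm x)) e)).snd = _
    rw [ω.apply_symm_apply]
  · rw [LinearIsometryEquiv.symm_apply_eq, hω0]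
  · change ω.symm (G.P k (ω (col h w))) = _
    rw [LinearIsometryEquiv.symm_apply_eq, hω, hω, map_add, hQ]
    rfl

theorem block22_inl_apply {W : Type*} [NormedAddCommGroup W] [InnerProductSpace ℂ W]
    (z : HSum M E) : (block22 (inl M W) 0 0 1 : HSum M E →L[ℂ] HSum (HSum M W) E) z =
      col (col z.fst 0) z.snd := by
  rw [← col_eta z, block22_col]
  simp [inl]

/-- A continuous linear relation on the closed span of a family is checked on the family. -/
theorem apply_eq_of_generators {ι W : Type*} [NormedAddCommGroup W] [InnerProductSpace ℂ W]
    (g : ι → HSum M E) (hmem : ∀ i, g i ∈ (Submodule.span ℂ (Set.range g)).topologicalClosure)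
    {R : Submodule ℂ (HSum M F)}
    (V : (Submodule.span ℂ (Set.range g)).topologicalClosure ≃ₗᵢ[ℂ] R)
    (U : HSum (HSum M W) E ≃ₗᵢ[ℂ] HSum (HSum M W) F)
    (h : ∀ i, U (col (col (g i).fst 0) (g i).snd) =
      col (col (V ⟨g i, hmem i⟩ : HSum M F).fst 0) (V ⟨g i, hmem i⟩ : HSum M F).snd)
    (x : (Submodule.span ℂ (Set.range g)).topologicalClosure) :
    U (col (col (x : HSum M E).fst 0) (x : HSum M E).snd) =
      col (col (V x : HSum M F).fst 0) (V x : HSum M F).snd := by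
  have key : (U.toContinuousLinearEquiv : HSum (HSum M W) E →L[ℂ] HSum (HSum M W) F) ∘L
      block22 (inl M W) 0 0 1 ∘L Submodule.subtypeL _ =
      block22 (inl M W) 0 0 1 ∘L R.subtypeL ∘L
        (V.toContinuousLinearEquiv : (Submodule.span ℂ (Set.range g)).topologicalClosure →L[ℂ] R) :=
    eq_of_eqOn_generators (topologicalClosure_span_eq_top g hmem) fun i => by
      change U (block22 (inl M W) 0 0 1 (g i)) = block22 (inl M W) 0 0 1 (V ⟨g i, hmem i⟩).1
      rw [block22_inl_apply, block22_inl_apply]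
      exact h i
  have hx := DFunLike.congr_fun key x
  change U (block22 (inl M W) 0 0 1 x.1) = block22 (inl M W) 0 0 1 (V x).1 at hx
  rwa [block22_inl_apply, block22_inl_apply] at hx

/-- Isometries into the ranges of the projections add up to an isometry on the orthogonal sum. -/
theorem GRUnitary.exists_isometry_sum {H : Fin d → Type*} [∀ k, NormedAddCommGroup (H k)]
    [∀ k, InnerProductSpace ℂ (H k)] (G : GRUnitary d X E F) (i : ∀ k, H k →ₗᵢ[ℂ] X)
    (hi : ∀ k f, G.P k (i k f) = i k f) :
    ∃ J : PiLp 2 H →ₗᵢ[ℂ] X, (∀ k h, G.P k (J h) = J (coordProj H k h)) ∧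
      ∀ h, J h = ∑ k, i k (h k) := by
  have ho : ∀ j k f f', j ≠ k → ⟪i j f, i k f'⟫ = 0 := fun j k f f' hjk => by
    rw [← hi j, ← G.adjoint_P, ContinuousLinearMap.adjoint_inner_left, ← hi k, G.P_P_of_ne hjk,
      inner_zero_right]
  let T : PiLp 2 H →ₗ[ℂ] X := ∑ k, (i k).toLinearMap ∘ₗ (PiLp.proj 2 H k).toLinearMap
  have hT : ∀ h, T h = ∑ k, i k (h k) := fun h => by
    simp [T]
  refine ⟨T.isometryOfInner fun f f' => ?_, fun k h => ?_, hT⟩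
  · rw [hT, hT, sum_inner, PiLp.inner_apply]
    refine Finset.sum_congr rfl fun k _ => ?_
    rw [inner_sum, Finset.sum_eq_single k, LinearIsometry.inner_map_map]
    · exact fun j _ hj => ho k j _ _ hj.symm
    · simp
  · change G.P k (T h) = T (coordProj H k h)
    rw [hT, hT, coordProj_apply, map_sum, Finset.sum_eq_single k, Finset.sum_eq_single k, hi]
    · simp
    · intro j _ hj
      simp [hj]
    · simp
    · intro j _ hj
      rw [← hi j, G.P_P_of_ne hj.symm]
    · simp

end Transport

namespace AugAglerDecomposition

variable {d : ℕ} {E Es : Type*}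
  [NormedAddCommGroup E] [InnerProductSpace ℂ E] [CompleteSpace E]
  [NormedAddCommGroup Es] [InnerProductSpace ℂ Es] [CompleteSpace Es]
  {S : (Fin d →₀ ℕ) → E →L[ℂ] Es} {𝒦 : AugAglerDecomposition S}

/-- The kernel functions, embedded into the state space of a unitary extension of `V`, satisfy the
hypotheses of `realizes_of_apply_generator`. -/
theorem IsExtension.realizes_and_compatible {Ht : Type*} [NormedAddCommGroup Ht]
    [InnerProductSpace ℂ Ht] [CompleteSpace Ht] {V : 𝒦.domD ≃ₗᵢ[ℂ] 𝒦.ranR} (hV : 𝒦.IsV V)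
    {G : GRUnitary d (HSum 𝒦.Model Ht) E Es} (hG : IsExtension V G) :
    G.Realizes S ∧ G.Compatible 𝒦.K := by
  obtain ⟨⟨Pt, hPt⟩, hU⟩ := hG
  let x : (Fin d → ℤ) → HSum Es E → HSum 𝒦.Model Ht := fun m u =>
    col (WithLp.toLp 2 fun k => RKHS.kerFun (𝒦.H k) m u) 0
  have hP : ∀ k m u, G.P k (x m u) = col (PiLp.single 2 k (RKHS.kerFun (𝒦.H k) m u)) 0 :=
    fun k m u => by rw [hPt, map_zero]
  have hz : ∀ m u, (∀ k, RKHS.kerFun (𝒦.H k) m u = 0) → x m u = 0 := fun m u h => by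
    simp only [x, h]
    rfl
  have hk : G.Realizes S ∧
      ∀ k m u, G.P k (x m u) = ContinuousLinearMap.adjoint (G.kernelFactor k m) u := by
    refine G.realizes_of_apply_generator x (fun m u => ?_) (fun m f e => ?_)
      (fun m f hm => hz _ _ fun k => 𝒦.kerFun_fst_eq_zero k hm f) (fun k m e hm => ?_)
    · have h1 := hU ⟨𝒦.genD m u, 𝒦.genD_mem m u⟩
      rw [hV] at h1
      refine h1.trans ?_
      have h2 : ∑ k, G.P k (x (m - unitIdx k) u) = col (𝒦.genR m u).fst 0 := by
        have h3 := DFunLike.congr_fun (sum_coordProj 𝒦.H) (𝒦.genR m u).fst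
        rw [_root_.sum_apply] at h3
        simp only [hP]
        rw [sum_col, Finset.sum_const_zero]
        exact congrArg (col · 0) h3
      rw [h2]
      rfl
    · have h1 : (col f e : HSum Es E) = col f 0 + col 0 e := by
        rw [col_add_col, add_zero, zero_add]
      have h2 : ∀ k, RKHS.kerFun (𝒦.H k) m (col f e) = RKHS.kerFun (𝒦.H k) m (col f 0) +
          RKHS.kerFun (𝒦.H k) m (col 0 e) := fun k => by rw [← map_add, ← h1]
      simp only [x, h2, col_add_col, add_zero]
      rfl
    · rw [hP, 𝒦.kerFun_snd_eq_zero k hm]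
      simp
  refine ⟨hk.1, fun k n m => ?_⟩
  ext1 u
  refine ext_inner_left ℂ fun v => ?_
  have hs : ∀ f f' : 𝒦.Model, ⟪(col f 0 : HSum 𝒦.Model Ht), col f' 0⟫ = ⟪f, f'⟫ := fun f f' =>
    inner_col_zero_left _ _
  rw [ContinuousLinearMap.comp_apply, ← ContinuousLinearMap.adjoint_inner_left (G.kernelFactor k n),
    ← hk.2, ← hk.2, hP, hP, hs, ← inner_kerFun_kerFun, PiLp.inner_apply, Finset.sum_eq_single k]
  · rw [PiLp.single_eq_same, PiLp.single_eq_same]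
  · intro j _ hj
    rw [PiLp.single_eq_of_ne (p := 2) hj, inner_zero_left]
  · simp

variable (𝒦) in
/-- A realization that is compatible with the kernels contains the model space. -/
theorem exists_isometry_of_compatible {X : Type*} [NormedAddCommGroup X] [InnerProductSpace ℂ X]
    [CompleteSpace X] (G : GRUnitary d X E Es) (h : G.Compatible 𝒦.K) :
    ∃ J : 𝒦.Model →ₗᵢ[ℂ] X, (∀ k h, G.P k (J h) = J (coordProj 𝒦.H k h)) ∧
      ∀ (m : Fin d → Fin d → ℤ) u, J (WithLp.toLp 2 fun k => RKHS.kerFun (𝒦.H k) (m k) u) =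
        ∑ k, ContinuousLinearMap.adjoint (G.kernelFactor k (m k)) u := by
  have hd : ∀ k, (Submodule.span ℂ (Set.range fun p : (Fin d → ℤ) × HSum Es E =>
      RKHS.kerFun (𝒦.H k) p.1 p.2)).topologicalClosure = ⊤ := fun k => by
    rw [← RKHS.kerFun_dense (𝕜 := ℂ) (H := 𝒦.H k)]
    congr 2
    ext f
    simp
  have hi : ∀ k, ∃ i : 𝒦.H k →ₗᵢ[ℂ] X, ∀ p : (Fin d → ℤ) × HSum Es E,
      i (RKHS.kerFun (𝒦.H k) p.1 p.2) = ContinuousLinearMap.adjoint (G.kernelFactor k p.1) p.2 :=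
    fun k => exists_isometry_of_gram (hd k) fun p q => by
      rw [inner_kerFun_kerFun, h, ContinuousLinearMap.adjoint_inner_left]
      rfl
  choose i hi using hi
  have hPi : ∀ k, G.P k ∘L (i k).toContinuousLinearMap = (i k).toContinuousLinearMap := fun k =>
    eq_of_eqOn_generators (hd k) fun p => by
      change G.P k (i k _) = i k _
      rw [hi, G.P_adjoint_kernelFactor]
  obtain ⟨J, hJP, hJ⟩ := G.exists_isometry_sum i fun k f => DFunLike.congr_fun (hPi k) f
  exact ⟨J, hJP, fun m u => (hJ _).trans (Finset.sum_congr rfl fun k _ => hi k (m k, u))⟩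

/-- A compatible realization is, up to unitary equivalence, a unitary extension of `V`: the
auxiliary space is the orthogonal complement of the image of the model space. -/
theorem exists_isExtension {X : Type w} [NormedAddCommGroup X] [InnerProductSpace ℂ X]
    [CompleteSpace X] {V : 𝒦.domD ≃ₗᵢ[ℂ] 𝒦.ranR} (hV : 𝒦.IsV V)
    (G : GRUnitary d X E Es) (hr : G.Realizes S) (hc : G.Compatible 𝒦.K) :
    ∃ (Ht : Type w) (_ : NormedAddCommGroup Ht) (_ : InnerProductSpace ℂ Ht)
      (_ : CompleteSpace Ht) (G' : GRUnitary d (HSum 𝒦.Model Ht) E Es),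
      IsExtension V G' ∧ G.UnitarilyEquivalent G' := by
  obtain ⟨J, hJP, hJ⟩ := exists_isometry_of_compatible 𝒦 G hc
  obtain ⟨W, i1, i2, i3, G', ω, hω, hωJ, Pt, hPt⟩ :=
    G.exists_equiv_sum (M := 𝒦.Model) J (coordProj 𝒦.H) hJP
  refine ⟨W, i1, i2, i3, G', ⟨⟨Pt, hPt⟩, ?_⟩, ω, hω⟩
  refine apply_eq_of_generators (M := 𝒦.Model) (E := E) (F := Es) (W := W)
    (fun p : (Fin d → ℤ) × HSum Es E => 𝒦.genD p.1 p.2) (fun p => 𝒦.genD_mem p.1 p.2)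
    (R := 𝒦.ranR) V G'.U fun p => ?_
  have h1 := hr.apply_generator p.1 p.2
  have h2 := hω.2 (∑ k, ContinuousLinearMap.adjoint (G.kernelFactor k p.1) p.2)
    (ContinuousLinearMap.adjoint (laurent S p.1) p.2.fst + delta p.1 • p.2.snd)
  rw [h1, ← hJ fun _ => p.1, WithLp.toLp_fst, WithLp.toLp_snd,
    ← hJ fun k => p.1 - unitIdx k, hωJ] at h2
  have h3 := hV p.1 p.2
  refine h2.trans ?_
  rw [WithLp.toLp_fst, hωJ]
  exact (congrArg (fun y : 𝒦.ranR => (col (col (y : HSum 𝒦.Model Es).fst 0)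
    (y : HSum 𝒦.Model Es).snd : HSum (HSum 𝒦.Model W) Es)) h3).symm

end AugAglerDecomposition

end GivoneRoesser

end

theorem theorem7p1 {d : ℕ} {E : Type u} {Es : Type v}
    [NormedAddCommGroup E] [InnerProductSpace ℂ E] [CompleteSpace E]
    [NormedAddCommGroup Es] [InnerProductSpace ℂ Es] [CompleteSpace Es]
    (S : (Fin d →₀ ℕ) → E →L[ℂ] Es) (hS : IsSchurAgler S) (𝒦 : AugAglerDecomposition S) :
    -- `V : 𝓓 → 𝓡` and `U₀` are well defined
    (∃! V : 𝒦.domD ≃ₗᵢ[ℂ] 𝒦.ranR, 𝒦.IsV V) ∧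
    (∀ V : 𝒦.domD ≃ₗᵢ[ℂ] 𝒦.ranR, 𝒦.IsV V →
      ∃! U₀ : HSum (HSum 𝒦.Model E) 𝒦.L' ≃ₗᵢ[ℂ] HSum (HSum 𝒦.Model Es) 𝒦.L, 𝒦.IsU₀ V U₀) ∧
    ∀ (V : 𝒦.domD ≃ₗᵢ[ℂ] 𝒦.ranR)
      (U₀ : HSum (HSum 𝒦.Model E) 𝒦.L' ≃ₗᵢ[ℂ] HSum (HSum 𝒦.Model Es) 𝒦.L),
      𝒦.IsV V → 𝒦.IsU₀ V U₀ →
      -- (1) compatible realizations are, up to unitary equivalence, unitary extensions of `V`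
      (∀ (X : Type w) [NormedAddCommGroup X] [InnerProductSpace ℂ X] [CompleteSpace X]
        (G : GRUnitary d X E Es), G.Realizes S → G.Compatible 𝒦.K →
        ∃ (Ht : Type w) (_ : NormedAddCommGroup Ht) (_ : InnerProductSpace ℂ Ht)
          (_ : CompleteSpace Ht) (G' : GRUnitary d (HSum 𝒦.Model Ht) E Es),
          AugAglerDecomposition.IsExtension V G' ∧ G.UnitarilyEquivalent G') ∧
      -- and every unitary extension of `V` is a compatible realization
      (∀ (Ht : Type w) [NormedAddCommGroup Ht] [InnerProductSpace ℂ Ht] [CompleteSpace Ht]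
        (G : GRUnitary d (HSum 𝒦.Model Ht) E Es),
        AugAglerDecomposition.IsExtension V G → G.Realizes S ∧ G.Compatible 𝒦.K) ∧
      -- (2) the feedback connection is a bijection between loads and unitary extensions of `V`,
      -- given by the Redheffer formula
      (∀ (Ht : Type w) [NormedAddCommGroup Ht] [InnerProductSpace ℂ Ht] [CompleteSpace Ht],
        (∀ Gt : GRUnitary d Ht 𝒦.L 𝒦.L', ∃! G : GRUnitary d (HSum 𝒦.Model Ht) E Es,
          AugAglerDecomposition.IsFeedback U₀ Gt G) ∧
        (∀ G : GRUnitary d (HSum 𝒦.Model Ht) E Es, AugAglerDecomposition.IsExtension V G →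
          ∃! Gt : GRUnitary d Ht 𝒦.L 𝒦.L', AugAglerDecomposition.IsFeedback U₀ Gt G) ∧
        (∀ (Gt : GRUnitary d Ht 𝒦.L 𝒦.L') (G : GRUnitary d (HSum 𝒦.Model Ht) E Es),
          AugAglerDecomposition.IsFeedback U₀ Gt G →
          AugAglerDecomposition.IsExtension V G ∧
          G.op = redhefferParam (AugAglerDecomposition.opU₀ U₀) Gt.op ∧
          G.op = explicitParam (AugAglerDecomposition.opU₀ U₀) Gt.op)) ∧
      -- (3) when the load is closely connected
      (∀ (Ht : Type w) [NormedAddCommGroup Ht] [InnerProductSpace ℂ Ht] [CompleteSpace Ht]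
        (Gt : GRUnitary d Ht 𝒦.L 𝒦.L') (G : GRUnitary d (HSum 𝒦.Model Ht) E Es),
        AugAglerDecomposition.IsFeedback U₀ Gt G →
        (Gt.CloselyConnected ↔
          ¬ ∃ M : Submodule ℂ (HSum 𝒦.Model Ht), M ≠ ⊥ ∧
            IsClosed (M : Set (HSum 𝒦.Model Ht)) ∧
            (∀ x ∈ M, x.fst = 0) ∧
            (fun x => G.U (col x 0)) '' (M : Set (HSum 𝒦.Model Ht)) =
              (fun x => col x 0) '' (M : Set (HSum 𝒦.Model Ht)) ∧
            ∀ k, ∀ x ∈ M, G.P k x ∈ M)) ∧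
      -- (4) when two loads are unitarily equivalent
      (∀ (Ht Ht' : Type w) [NormedAddCommGroup Ht] [InnerProductSpace ℂ Ht] [CompleteSpace Ht]
        [NormedAddCommGroup Ht'] [InnerProductSpace ℂ Ht'] [CompleteSpace Ht']
        (Gt : GRUnitary d Ht 𝒦.L 𝒦.L') (Gt' : GRUnitary d Ht' 𝒦.L 𝒦.L')
        (G : GRUnitary d (HSum 𝒦.Model Ht) E Es) (G' : GRUnitary d (HSum 𝒦.Model Ht') E Es),
        AugAglerDecomposition.IsFeedback U₀ Gt G → AugAglerDecomposition.IsFeedback U₀ Gt' G' →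
        (Gt.UnitarilyEquivalent Gt' ↔
          ∃ ω : HSum 𝒦.Model Ht ≃ₗᵢ[ℂ] HSum 𝒦.Model Ht',
            GRUnitary.EquivVia ω G G' ∧ ∀ h : 𝒦.Model, ω (col h 0) = col h 0)) := by
  refine ⟨𝒦.existsUnique_isV, fun V _ => AugAglerDecomposition.existsUnique_isU₀ V,
    fun V U₀ hV hU₀ => ⟨fun X _ _ _ G hr hc => AugAglerDecomposition.exists_isExtension hV G hr hc,
      fun Ht _ _ _ G hG => hG.realizes_and_compatible hV, fun Ht _ _ _ =>
        ⟨fun Gt => AugAglerDecomposition.existsUnique_isFeedback hU₀ Gt,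
          fun G hG => AugAglerDecomposition.existsUnique_load hU₀ G hG,
          fun Gt G hG => ⟨hG.isExtension hU₀, ?_, hG.op_eq_explicitParam hU₀⟩⟩,
      fun Ht _ _ _ Gt G hG => hG.closelyConnected_iff hU₀,
      fun Ht Ht' _ _ _ _ _ _ Gt Gt' G G' hG hG' => hG.unitarilyEquivalent_iff hU₀ hG'⟩⟩
  rw [redhefferParam_eq_explicitParam (M := 𝒦.Model) (E := E) (F := Es) (L := 𝒦.L) (L' := 𝒦.L')]
  exact hG.op_eq_explicitParam hU₀
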